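/- **Proposition.** Let $Q$ be a smooth finite-dimensional manifold, $\tau_Q:TQ\to Q$ its tangent bundle with bundle coordinates $(q^i,\dot q^i)$, $S=\mathrm{d}q^i\otimes\partial/\partial\dot q^i$ the vertical endomorphism and $\Delta=\dot q^i\,\partial/\partial\dot q^i$ the Liouville vector field of $TQ$. Let $(L,\beta)$ be a forced Lagrangian system: $L:TQ\to\mathbb{R}$ is a smooth regular Lagrangian (its fibre Hessian $\partial^2L/\partial\dot q^i\partial\dot q^j$ is invertible everywhere) and $\beta$ is a smooth semibasic 1-form on $TQ$. Put $\alpha_L=S^*(\mathrm{d}L)$, $\omega_L=-\mathrm{d}\alpha_L$, $E_L=\Delta(L)-L$, and let $\xi_{L,\beta}$ be the forced Euler–Lagrange vector field, given by $\iota_{\xi_{L,\beta}}\omega_L=\mathrm{d}E_L+\beta$. A function $g$ on $TQ$ is a *conserved quantity* if $\xi_{L,\beta}(g)=0$. For a smooth vector field $X=X^i\,\partial/\partial q^i$ on $Q$ let $X^v=X^i\,\partial/\partial\dot q^i$ and $X^c=X^i\,\partial/\partial q^i+\dot q^j\,(\partial X^i/\partial q^j)\,\partial/\partial\dot q^i$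 be its vertical and complete lifts to $TQ$. Call $X$ a *symmetry of the forced Lagrangian system* if $X^c(L)=\beta(X^c)$, and a *Noether symmetry* if $X^c(E_L)+\beta(X^c)=0$ and $\mathcal{L}_{X^c}\alpha_L$ is exact (that is, equal to $\mathrm{d}f$ for some smooth $f:TQ\to\mathbb{R}$). Then, for every smooth vector field $X$ on $Q$: 1. If $f:TQ\to\mathbb{R}$ is smooth and $\mathcal{L}_{X^c}\alpha_L=\mathrm{d}f$, then $X$ is a Noether symmetry if and only if $f-X^v(L)$ is a conserved quantity. 2. $X$ is a symmetry of the forced Lagrangian system if and only if $X^v(L)$ is a conserved quantity. 3. If $X$ is a symmetry of the forced Lagrangian system, then $X$ is a Noether symmetry if and only if $\mathcal{L}_{X^c}\alpha_L=0$. In particular, every symmetry of the forced Lagrangian system with $\mathcal{L}_{X^c}\alpha_L=0$ is a Noether symmetry. -/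

import Mathlib

open scoped Manifold ContDiff

noncomputable section

namespace ForcedLagrangian

/-! ### Calculus of 1-forms on a manifold without boundary -/

section Forms

variable {F : Type*} [NormedAddCommGroup F] [NormedSpace ℝ F]
  {H : Type*} [TopologicalSpace H] (J : ModelWithCorners ℝ F H)
  {M : Type*} [TopologicalSpace M] [ChartedSpace H M]

/-- A (not necessarily smooth) vector field on `M`. -/
abbrev VField (M : Type*) [TopologicalSpace M] [ChartedSpace H M] : Type _ :=
  (p : M) → TangentSpace J p

/-- A (not necessarily smooth) 1-form on `M`. -/
abbrev OneForm (M : Type*) [TopologicalSpace M] [ChartedSpace H M] : Type _ :=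
  (p : M) → (TangentSpace J p →L[ℝ] ℝ)

/-- Smoothness of a vector field, as a section of the tangent bundle. -/
def SmoothVField [IsManifold J 1 M] (Y : VField J M) : Prop :=
  ContMDiff J J.tangent ∞ (fun p => (⟨p, Y p⟩ : TangentBundle J M))

/-- Smoothness of a 1-form, as a section of the cotangent bundle `Hom(TM, ℝ)`. -/
def SmoothOneForm [IsManifold J 1 M] (α : OneForm J M) : Prop :=
  ContMDiff J (J.prod 𝓘(ℝ, F →L[ℝ] ℝ)) ∞
    (fun p => Bundle.TotalSpace.mk' (F →L[ℝ] ℝ)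
      (E := fun p : M => TangentSpace J p →L[ℝ] Bundle.Trivial M ℝ p) p (α p))

/-- The differential of a real-valued function. -/
def dFun (f : M → ℝ) : OneForm J M :=
  fun p => mfderiv J 𝓘(ℝ, ℝ) f p

/-- The 1-form `α` in the preferred chart `φ` at `p₀`: the form `(φ⁻¹)^* α` on the model space. -/
def formInChart (α : OneForm J M) (p₀ : M) : F → (F →L[ℝ] ℝ) :=
  fun y => (α ((extChartAt J p₀).symm y)).comp
    (mfderiv 𝓘(ℝ, F) J (extChartAt J p₀).symm y)

/-- The vector field `Y` in the preferred chart at `p₀`, as a vector field on the model space. -/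
def fieldInChart (Y : VField J M) (p₀ : M) : F → F :=
  VectorField.mpullback 𝓘(ℝ, F) J (extChartAt J p₀).symm Y

/-- The exterior derivative of a 1-form, `(dα)(u, w)`; in coordinates
`(dα)(u, w) = (∂ᵢ αⱼ) (uⁱ wʲ - wⁱ uʲ)`. -/
def extDerivForm (α : OneForm J M) (p : M) :
    TangentSpace J p →L[ℝ] TangentSpace J p →L[ℝ] ℝ :=
  let D : F →L[ℝ] F →L[ℝ] ℝ := fderiv ℝ (formInChart J α p) (extChartAt J p p)
  let T : F →L[ℝ] F := mfderiv J 𝓘(ℝ, F) (extChartAt J p) p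
  let B : F →L[ℝ] F →L[ℝ] ℝ := (D - D.flip).bilinearComp T T
  B

/-- The Lie derivative of a 1-form `α` along a vector field `Y`; in coordinates
`(ℒ_Y α)ᵢ = Yʲ ∂ⱼ αᵢ + αⱼ ∂ᵢ Yʲ`. -/
def lieDerivForm (Y : VField J M) (α : OneForm J M) : OneForm J M :=
  fun p =>
    let x : F := extChartAt J p p
    let T : TangentSpace J p →L[ℝ] F := mfderiv J 𝓘(ℝ, F) (extChartAt J p) p
    (fderiv ℝ (formInChart J α p) x (fieldInChart J Y p x) +
      (formInChart J α p x).comp (fderiv ℝ (fieldInChart J Y p) x)).comp T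

end Forms

/-! ### The geometry of the tangent bundle, and forced Lagrangian systems -/

section Tangent

variable {E : Type*} [NormedAddCommGroup E] [NormedSpace ℝ E]
  {Q : Type*} [TopologicalSpace Q] [ChartedSpace E Q] [IsManifold 𝓘(ℝ, E) ∞ Q]

/-- The vertical lift `T_q Q → T_v (TQ)` of tangent vectors at `v ∈ T_q Q`: the derivative at `v`
of the inclusion of the fibre `T_q Q` in `TQ`. In bundle coordinates, `wⁱ ↦ wⁱ ∂/∂q̇ⁱ`. -/
def vertLift (v : TangentBundle 𝓘(ℝ, E) Q) :
    TangentSpace 𝓘(ℝ, E) v.proj →L[ℝ] TangentSpace 𝓘(ℝ, E).tangent v :=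
  mfderiv 𝓘(ℝ, E) 𝓘(ℝ, E).tangent
    (fun w : E => (⟨v.proj, w⟩ : TangentBundle 𝓘(ℝ, E) Q)) v.snd

/-- The derivative `T_v (TQ) → T_q Q` of the projection `τ_Q : TQ → Q`. -/
def dProj (v : TangentBundle 𝓘(ℝ, E) Q) :
    TangentSpace 𝓘(ℝ, E).tangent v →L[ℝ] TangentSpace 𝓘(ℝ, E) v.proj :=
  mfderiv 𝓘(ℝ, E).tangent 𝓘(ℝ, E)
    (fun w : TangentBundle 𝓘(ℝ, E) Q => w.proj) v

/-- The vertical endomorphism `S = dqⁱ ⊗ ∂/∂q̇ⁱ` of `TQ`. -/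
def vertEndo (v : TangentBundle 𝓘(ℝ, E) Q) :
    TangentSpace 𝓘(ℝ, E).tangent v →L[ℝ] TangentSpace 𝓘(ℝ, E).tangent v :=
  (vertLift v).comp (dProj v)

/-- The Liouville vector field `Δ = q̇ⁱ ∂/∂q̇ⁱ`. -/
def liouville : VField 𝓘(ℝ, E).tangent (TangentBundle 𝓘(ℝ, E) Q) :=
  fun v => vertLift v v.snd

/-- The vertical lift `X^v = Xⁱ ∂/∂q̇ⁱ` of a vector field on `Q`. -/
def vLift (X : VField 𝓘(ℝ, E) Q) : VField 𝓘(ℝ, E).tangent (TangentBundle 𝓘(ℝ, E) Q) :=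
  fun v => vertLift v (X v.proj)

/-- The complete lift of a vector field on `Q`. At `v ∈ T_q Q` it is
`X^c = Xⁱ ∂/∂qⁱ + q̇ʲ (∂Xⁱ/∂qʲ) ∂/∂q̇ⁱ` in the bundle coordinates `(q, q̇)` of `TQ` around `v` that
are induced by the preferred chart of `Q` at `q`. -/
def cLift (X : VField 𝓘(ℝ, E) Q) : VField 𝓘(ℝ, E).tangent (TangentBundle 𝓘(ℝ, E) Q) :=
  fun v =>
    let x : E := extChartAt 𝓘(ℝ, E) v.proj v.proj
    let y : E := mfderiv 𝓘(ℝ, E) 𝓘(ℝ, E) (extChartAt 𝓘(ℝ, E) v.proj) v.proj v.snd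
    let X' : E → E := fieldInChart 𝓘(ℝ, E) X v.proj
    (mfderiv 𝓘(ℝ, E).tangent 𝓘(ℝ, E × E) (extChartAt 𝓘(ℝ, E).tangent v) v).inverse
      ((X' x, fderiv ℝ X' x y) : E × E)

/-- A 1-form on `TQ` is semibasic if it vanishes on vertical vectors. -/
def Semibasic (β : OneForm 𝓘(ℝ, E).tangent (TangentBundle 𝓘(ℝ, E) Q)) : Prop :=
  ∀ (v : TangentBundle 𝓘(ℝ, E) Q) (u : TangentSpace 𝓘(ℝ, E).tangent v),
    dProj v u = 0 → β v u = 0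

/-- `L` is regular: the Hessian `∂²L/∂q̇ⁱ∂q̇ʲ` of `L` along the fibres of `TQ`, as a map from
`T_q Q` to its dual, is invertible at every point of `TQ`. -/
def Regular (L : TangentBundle 𝓘(ℝ, E) Q → ℝ) : Prop :=
  ∀ v : TangentBundle 𝓘(ℝ, E) Q,
    (fderiv ℝ (fderiv ℝ (fun w : E => L ⟨v.proj, w⟩)) v.snd).IsInvertible

/-- The 1-form `α_L = S^*(dL)`. -/
def alphaForm (L : TangentBundle 𝓘(ℝ, E) Q → ℝ) :
    OneForm 𝓘(ℝ, E).tangent (TangentBundle 𝓘(ℝ, E) Q) :=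
  fun v => (dFun 𝓘(ℝ, E).tangent L v).comp (vertEndo v)

/-- The Poincaré–Cartan 2-form `ω_L = -dα_L`; `omegaForm L v u` is the covector `i_u ω_L`. -/
def omegaForm (L : TangentBundle 𝓘(ℝ, E) Q → ℝ) (v : TangentBundle 𝓘(ℝ, E) Q) :
    TangentSpace 𝓘(ℝ, E).tangent v →L[ℝ] TangentSpace 𝓘(ℝ, E).tangent v →L[ℝ] ℝ :=
  -extDerivForm 𝓘(ℝ, E).tangent (alphaForm L) v

/-- The energy `E_L = Δ(L) - L`. -/
def energy (L : TangentBundle 𝓘(ℝ, E) Q → ℝ) : TangentBundle 𝓘(ℝ, E) Q → ℝ :=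
  fun v => dFun 𝓘(ℝ, E).tangent L v (liouville v) - L v

/-- The forced Euler–Lagrange vector field `ξ_{L,β}`: the solution of
`i_ξ ω_L = dE_L + β`, obtained by inverting `u ↦ i_u ω_L` at each point (for regular `L`, `ω_L` is
nondegenerate). -/
def forcedEL (L : TangentBundle 𝓘(ℝ, E) Q → ℝ)
    (β : OneForm 𝓘(ℝ, E).tangent (TangentBundle 𝓘(ℝ, E) Q)) :
    VField 𝓘(ℝ, E).tangent (TangentBundle 𝓘(ℝ, E) Q) :=
  fun v => (omegaForm L v).inverse (dFun 𝓘(ℝ, E).tangent (energy L) v + β v)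

/-- `g` is a conserved quantity of the forced system: `ξ_{L,β}(g) = 0`. -/
def IsConserved (L : TangentBundle 𝓘(ℝ, E) Q → ℝ)
    (β : OneForm 𝓘(ℝ, E).tangent (TangentBundle 𝓘(ℝ, E) Q))
    (g : TangentBundle 𝓘(ℝ, E) Q → ℝ) : Prop :=
  ∀ v, dFun 𝓘(ℝ, E).tangent g v (forcedEL L β v) = 0

/-- `X` is a symmetry of the forced Lagrangian system: `X^c(L) = β(X^c)`. -/
def IsForcedSymmetry (L : TangentBundle 𝓘(ℝ, E) Q → ℝ)
    (β : OneForm 𝓘(ℝ, E).tangent (TangentBundle 𝓘(ℝ, E) Q)) (X : VField 𝓘(ℝ, E) Q) : Prop :=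
  ∀ v, dFun 𝓘(ℝ, E).tangent L v (cLift X v) = β v (cLift X v)

/-- `X` is a Noether symmetry: `X^c(E_L) + β(X^c) = 0` and `ℒ_{X^c} α_L` is exact. -/
def IsNoetherSymmetry (L : TangentBundle 𝓘(ℝ, E) Q → ℝ)
    (β : OneForm 𝓘(ℝ, E).tangent (TangentBundle 𝓘(ℝ, E) Q)) (X : VField 𝓘(ℝ, E) Q) : Prop :=
  (∀ v, dFun 𝓘(ℝ, E).tangent (energy L) v (cLift X v) + β v (cLift X v) = 0) ∧
    ∃ f : TangentBundle 𝓘(ℝ, E) Q → ℝ, ContMDiff 𝓘(ℝ, E).tangent 𝓘(ℝ, ℝ) ∞ f ∧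
      lieDerivForm 𝓘(ℝ, E).tangent (cLift X) (alphaForm L) = dFun 𝓘(ℝ, E).tangent f

end Tangent

end ForcedLagrangian

end

/-!
# Symmetries and conserved quantities of forced Lagrangian systems

Everything rests on two pointwise identities on `TQ`, with `ξ` the forced Euler–Lagrange field:

* `dFun_vLift_lagrangian_forcedEL`: `ξ(X^v(L)) = X^c(L) - β(X^c)`;
* `dFun_sub_vLift_lagrangian_forcedEL`: if `ℒ_{X^c} α_L = df`, then
  `ξ(f - X^v(L)) = X^c(E_L) + β(X^c)`.

They say that the left side vanishes identically exactly when the defining equation of a symmetry of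
the forced system, respectively of a Noether symmetry, holds.

The first identity is a computation in bundle coordinates `(q, q̇)`. Evaluating `i_ξ ω_L = dE_L + β`
on vertical vectors, where `β` vanishes, and using that the fibre Hessian is nondegenerate shows
that `ξ` is a second order equation, `ξ = q̇ⁱ ∂/∂qⁱ + …` (`forcedEL_fst`); evaluating it on the
remaining vectors gives `ξ(∂L/∂q̇ⁱ) = ∂L/∂qⁱ - βᵢ` (`forcedEL_eulerLagrange`). Inserting this in the
derivative of `X^v(L) = Xⁱ ∂L/∂q̇ⁱ` yields the claim.

The second identity is Cartan's formula `ℒ_{X^c} α_L = i_{X^c} dα_L + d(α_L(X^c))`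
(`lieDerivForm_eq_extDerivForm_add`): since `α_L(X^c) = X^v(L)`, it reads
`d(f - X^v(L)) = - i_{X^c} ω_L`, and `ω_L(ξ, X^c) = (dE_L + β)(X^c)`.

For the last claim, suppose that `X` is both a symmetry and a Noether symmetry. Then `f` and
`X^v(L)` differ by a conserved quantity and `X^v(L)` is conserved, so `ξ(f) = 0`. The form
`df = ℒ_{X^c} α_L` is semibasic (`lieDerivForm_cLift_alphaForm_vertical`), so `f` is the pullback of
a function `g` on `Q`; as `ξ` is a second order equation, `ξ(f) = 0` says `dg(v) = 0` for all `v`,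
whence `df = 0` (`dFun_eq_zero_of_vertical_of_forcedEL`).

The exterior and Lie derivatives at a point `p` are defined through the chart at `p`, so they
require the coordinate expressions of `α_L` and `X^c` on a whole neighbourhood of `p`. As `X^c` is
defined at each point through the chart at that point, this needs the independence of `X^c` of the
chart (`chartD_cLift`).
-/

noncomputable section

namespace ForcedLagrangian

/-! ### Functions, vector fields and 1-forms in a chart -/

section Charts

variable {F : Type*} [NormedAddCommGroup F] [NormedSpace ℝ F]
  {H : Type*} [TopologicalSpace H] (J : ModelWithCorners ℝ F H)
  {M : Type*} [TopologicalSpace M] [ChartedSpace H M]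

/-- The derivative at `p` of the preferred chart at `p₀`. The tangent space `TangentSpace J p` is
the model space `F` by definition, so this is an endomorphism of `F`; it is the identity for
`p = p₀`. -/
def chartD (p₀ p : M) : F →L[ℝ] F := mfderiv J 𝓘(ℝ, F) (extChartAt J p₀) p

/-- The derivative of the inverse of the preferred chart at `p₀`, as an endomorphism of the model
space. -/
def chartDSymm (p₀ : M) (x : F) : F →L[ℝ] F := mfderiv 𝓘(ℝ, F) J (extChartAt J p₀).symm x

variable [IsManifold J 1 M]

lemma chartD_self (p : M) : chartD J p p = ContinuousLinearMap.id ℝ F :=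
  mfderiv_extChartAt_self

/-- The chain rule for a function given in a chart. No smoothness of `g` is assumed beforehand: it
is read off from the coordinate expression `h`. -/
lemma dFun_eq_of_eventuallyEq_comp_chart {p₀ p : M} (hp : p ∈ (extChartAt J p₀).source)
    {g : M → ℝ} {h : F → ℝ} {h' : F →L[ℝ] ℝ}
    (hh : HasFDerivAt h h' (extChartAt J p₀ p)) (hg : g =ᶠ[nhds p] h ∘ extChartAt J p₀)
    (u : F) : dFun J g p u = h' (chartD J p₀ p u) := by
  have h1 : HasMFDerivAt J 𝓘(ℝ, F) (extChartAt J p₀) p (chartD (F := F) J p₀ p) :=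
    (mdifferentiableAt_extChartAt (by simpa using hp)).hasMFDerivAt
  exact DFunLike.congr_fun ((hh.hasMFDerivAt.comp p h1).congr_of_eventuallyEq hg).mfderiv u

lemma trivializationAt_snd_eq_chartD {p₀ p : M} (hp : p ∈ (extChartAt J p₀).source)
    (w : TangentSpace J p) :
    (trivializationAt F (TangentSpace J) p₀ ⟨p, w⟩).2 = chartD J p₀ p w := by
  have hp' : p ∈ (chartAt H p₀).source := by simpa using hp
  have h := TangentBundle.continuousLinearMapAt_trivializationAt (I := J) hp'
  rw [← Bundle.Trivialization.continuousLinearMapAt_apply_of_mem (R := ℝ) _ (by simpa using hp')]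
  exact DFunLike.congr_fun h w

variable [J.Boundaryless]

lemma chartDSymm_comp_chartD {p₀ p : M} (hp : p ∈ (extChartAt J p₀).source) :
    (chartDSymm J p₀ (extChartAt J p₀ p)).comp (chartD J p₀ p) = ContinuousLinearMap.id ℝ F := by
  have := mfderivWithin_extChartAt_symm_comp_mfderiv_extChartAt' (I := J) hp
  rw [J.range_eq_univ, mfderivWithin_univ] at this
  exact this

lemma chartD_comp_chartDSymm {p₀ p : M} (hp : p ∈ (extChartAt J p₀).source) :
    (chartD J p₀ p).comp (chartDSymm J p₀ (extChartAt J p₀ p)) = ContinuousLinearMap.id ℝ F := by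
  have := mfderiv_extChartAt_comp_mfderivWithin_extChartAt_symm' (I := J) hp
  rw [J.range_eq_univ, mfderivWithin_univ] at this
  exact this

lemma fieldInChart_extChartAt (Y : VField J M) {p₀ p : M} (hp : p ∈ (extChartAt J p₀).source) :
    fieldInChart J Y p₀ (extChartAt J p₀ p) = chartD J p₀ p (Y p) := by
  have h : (chartDSymm J p₀ (extChartAt J p₀ p)).inverse = chartD J p₀ p :=
    ContinuousLinearMap.inverse_eq (chartDSymm_comp_chartD J hp) (chartD_comp_chartDSymm J hp)
  have h2 : fieldInChart J Y p₀ (extChartAt J p₀ p) =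
      (chartDSymm J p₀ (extChartAt J p₀ p)).inverse
        (Y ((extChartAt J p₀).symm (extChartAt J p₀ p)) : F) := rfl
  rw [h2, h, (extChartAt J p₀).left_inv hp]

lemma formInChart_extChartAt (α : OneForm J M) {p₀ p : M} (hp : p ∈ (extChartAt J p₀).source)
    (u : F) : formInChart J α p₀ (extChartAt J p₀ p) (chartD J p₀ p u) = α p u := by
  have h2 : formInChart J α p₀ (extChartAt J p₀ p) (chartD J p₀ p u) =
      (α ((extChartAt J p₀).symm (extChartAt J p₀ p)) : F →L[ℝ] ℝ)
        ((chartDSymm J p₀ (extChartAt J p₀ p)).comp (chartD J p₀ p) u) := rfl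
  rw [h2, chartDSymm_comp_chartD J hp, (extChartAt J p₀).left_inv hp]
  rfl

/-- `formInChart` at a coordinate vector `w` is the form at the tangent vector with
coordinates `w`. -/
lemma formInChart_apply (α : OneForm J M) {p₀ : M} {x : F} (hx : x ∈ (extChartAt J p₀).target)
    (w : F) : ∃ u : F, chartD J p₀ ((extChartAt J p₀).symm x) u = w ∧
      formInChart J α p₀ x w = α ((extChartAt J p₀).symm x) u := by
  have hp := (extChartAt J p₀).map_target hx
  have hx' := (extChartAt J p₀).right_inv hx
  refine ⟨chartDSymm J p₀ x w, ?_, rfl⟩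
  have := DFunLike.congr_fun (chartD_comp_chartDSymm J hp) w
  rwa [hx'] at this

omit [IsManifold J 1 M] [J.Boundaryless] in
lemma contDiffOn_comp_chart_symm [IsManifold J ∞ M] {g : M → ℝ} (hg : ContMDiff J 𝓘(ℝ, ℝ) ∞ g)
    (p₀ : M) : ContDiffOn ℝ ∞ (g ∘ (extChartAt J p₀).symm) (extChartAt J p₀).target := by
  rw [← contMDiffOn_iff_contDiffOn]
  exact hg.comp_contMDiffOn (contMDiffOn_extChartAt_symm p₀)

omit [IsManifold J 1 M] in
lemma contDiffAt_comp_chart_symm [IsManifold J ∞ M] {g : M → ℝ} (hg : ContMDiff J 𝓘(ℝ, ℝ) ∞ g)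
    {p₀ p : M} (hp : p ∈ (extChartAt J p₀).source) :
    ContDiffAt ℝ ∞ (g ∘ (extChartAt J p₀).symm) (extChartAt J p₀ p) :=
  (contDiffOn_comp_chart_symm J hg p₀).contDiffAt
    (extChartAt_target_mem_nhds' ((extChartAt J p₀).map_source hp))

omit [IsManifold J 1 M] [J.Boundaryless] in
lemma eventuallyEq_comp_chart_symm_comp_chart {G : Type*} (g : M → G) {p₀ p : M}
    (hp : p ∈ (extChartAt J p₀).source) :
    g =ᶠ[nhds p] (g ∘ (extChartAt J p₀).symm) ∘ extChartAt J p₀ := by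
  filter_upwards [extChartAt_source_mem_nhds' hp] with q hq
  exact congrArg g ((extChartAt J p₀).left_inv hq).symm

lemma dFun_eq_fderiv_comp_chartD [IsManifold J ∞ M] {g : M → ℝ} (hg : ContMDiff J 𝓘(ℝ, ℝ) ∞ g)
    {p₀ p : M} (hp : p ∈ (extChartAt J p₀).source) (u : F) :
    dFun J g p u =
      fderiv ℝ (g ∘ (extChartAt J p₀).symm) (extChartAt J p₀ p) (chartD J p₀ p u) :=
  dFun_eq_of_eventuallyEq_comp_chart J hp
    ((contDiffAt_comp_chart_symm J hg hp).differentiableAt (by simp)).hasFDerivAt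
    (eventuallyEq_comp_chart_symm_comp_chart J g hp) u

lemma lieDerivForm_apply (Y : VField J M) (α : OneForm J M) (p : M) (u : F) :
    lieDerivForm J Y α p u =
      fderiv ℝ (formInChart J α p) (extChartAt J p p) (Y p : F) u +
        (α p : F →L[ℝ] ℝ) (fderiv ℝ (fieldInChart J Y p) (extChartAt J p p) u) := by
  have hp := mem_extChartAt_source (I := J) p
  have h2 : lieDerivForm J Y α p u =
      fderiv ℝ (formInChart J α p) (extChartAt J p p) (fieldInChart J Y p (extChartAt J p p))
        (chartD J p p u) + formInChart J α p (extChartAt J p p)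
          (fderiv ℝ (fieldInChart J Y p) (extChartAt J p p) (chartD J p p u)) := rfl
  have h3 := formInChart_extChartAt J α hp
    (fderiv ℝ (fieldInChart J Y p) (extChartAt J p p) (chartD J p p u))
  rw [h2, fieldInChart_extChartAt J Y hp]
  rw [chartD_self] at h3 ⊢
  exact congrArg _ h3

omit [J.Boundaryless] in
lemma extDerivForm_apply (α : OneForm J M) (p : M) (u w : F) :
    extDerivForm J α p u w =
      fderiv ℝ (formInChart J α p) (extChartAt J p p) u w -
        fderiv ℝ (formInChart J α p) (extChartAt J p p) w u := by
  have h2 : extDerivForm J α p u w =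
      fderiv ℝ (formInChart J α p) (extChartAt J p p) (chartD J p p u) (chartD J p p w) -
        fderiv ℝ (formInChart J α p) (extChartAt J p p) (chartD J p p w) (chartD J p p u) := rfl
  rw [h2, chartD_self]
  rfl

/-- Cartan's formula `ℒ_Y α = i_Y dα + d(α(Y))`. -/
lemma lieDerivForm_eq_extDerivForm_add (Y : VField J M) (α : OneForm J M) (p : M)
    (hα : DifferentiableAt ℝ (formInChart J α p) (extChartAt J p p))
    (hY : DifferentiableAt ℝ (fieldInChart J Y p) (extChartAt J p p)) (u : F) :
    lieDerivForm J Y α p u = extDerivForm J α p (Y p) u + dFun J (fun q => α q (Y q)) p u := by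
  have hp := mem_extChartAt_source (I := J) p
  have hg : (fun q => α q (Y q)) =ᶠ[nhds p]
      (fun x => formInChart J α p x (fieldInChart J Y p x)) ∘ extChartAt J p := by
    filter_upwards [extChartAt_source_mem_nhds (I := J) p] with q hq
    exact ((congrArg _ (fieldInChart_extChartAt J Y hq)).trans
      (formInChart_extChartAt J α hq (Y q))).symm
  have hd := dFun_eq_of_eventuallyEq_comp_chart J hp (hα.hasFDerivAt.clm_apply hY.hasFDerivAt) hg u
  have h3 := formInChart_extChartAt J α hp
    (fderiv ℝ (fieldInChart J Y p) (extChartAt J p p) u)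
  rw [chartD_self] at hd h3
  have hY0 := fieldInChart_extChartAt J Y hp
  rw [chartD_self] at hY0
  have hu : dFun J (fun q => α q (Y q)) p u =
      formInChart J α p (extChartAt J p p) (fderiv ℝ (fieldInChart J Y p) (extChartAt J p p) u) +
      fderiv ℝ (formInChart J α p) (extChartAt J p p) u (fieldInChart J Y p (extChartAt J p p)) :=
    hd
  rw [lieDerivForm_apply, hu, hY0]
  have h4 := extDerivForm_apply J α p (Y p) u
  have h3' : formInChart J α p (extChartAt J p p)
      (fderiv ℝ (fieldInChart J Y p) (extChartAt J p p) u) =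
      (α p : F →L[ℝ] ℝ) (fderiv ℝ (fieldInChart J Y p) (extChartAt J p p) u) := h3
  rw [h3']
  have hY1 : (ContinuousLinearMap.id ℝ F) (Y p : F) = (Y p : F) := rfl
  rw [hY1]
  linear_combination -h4

/-- A smooth vector field has smooth components in a chart. -/
lemma contDiffOn_fieldInChart [IsManifold J ∞ M] {Y : VField J M}
    (hY : SmoothVField J Y) (p₀ : M) :
    ContDiffOn ℝ ∞ (fieldInChart J Y p₀) (extChartAt J p₀).target := by
  have h1 : ContMDiffOn J 𝓘(ℝ, F) ∞
      (fun q => (trivializationAt F (TangentSpace J) p₀ ⟨q, Y q⟩).2) (extChartAt J p₀).source := by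
    intro q hq
    refine (((trivializationAt F (TangentSpace J) p₀).contMDiffAt_section_iff ?_).1
      (hY q)).contMDiffWithinAt
    simpa using hq
  rw [← contMDiffOn_iff_contDiffOn]
  refine (h1.comp (contMDiffOn_extChartAt_symm p₀)
    (fun x hx => (extChartAt J p₀).map_target hx)).congr fun x hx => ?_
  have hp := (extChartAt J p₀).map_target hx
  have h2 := fieldInChart_extChartAt J Y hp
  rw [(extChartAt J p₀).right_inv hx] at h2
  rw [h2]
  exact (trivializationAt_snd_eq_chartD J hp _).symm

end Charts

/-! ### Changes of coordinates -/

section Transition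

variable {F : Type*} [NormedAddCommGroup F] [NormedSpace ℝ F]
  {H : Type*} [TopologicalSpace H] (J : ModelWithCorners ℝ F H)
  {M : Type*} [TopologicalSpace M] [ChartedSpace H M] [J.Boundaryless]

/-- The change of coordinates from the preferred chart at `p₁` to the preferred chart at `p₀`. -/
def transition (p₀ p₁ : M) : F → F := extChartAt J p₀ ∘ (extChartAt J p₁).symm

omit [J.Boundaryless] in
lemma transition_extChartAt {p₀ p₁ p : M} (hp₁ : p ∈ (extChartAt J p₁).source) :
    transition J p₀ p₁ (extChartAt J p₁ p) = extChartAt J p₀ p :=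
  congrArg _ ((extChartAt J p₁).left_inv hp₁)

lemma contDiffAt_transition [IsManifold J ∞ M] {p₀ p₁ p : M} (hp₀ : p ∈ (extChartAt J p₀).source)
    (hp₁ : p ∈ (extChartAt J p₁).source) :
    ContDiffAt ℝ ∞ (transition J p₀ p₁) (extChartAt J p₁ p) := by
  have h1 : ContMDiffAt 𝓘(ℝ, F) J ∞ (extChartAt J p₁).symm (extChartAt J p₁ p) :=
    (contMDiffOn_extChartAt_symm p₁).contMDiffAt
      (extChartAt_target_mem_nhds' ((extChartAt J p₁).map_source hp₁))
  have h2 : ContMDiffAt J 𝓘(ℝ, F) ∞ (extChartAt J p₀)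
      ((extChartAt J p₁).symm (extChartAt J p₁ p)) := by
    rw [(extChartAt J p₁).left_inv hp₁]
    exact contMDiffAt_extChartAt' (by simpa using hp₀)
  exact (h2.comp _ h1).contDiffAt

/-- The chain rule `Dτ ∘ Dφ₁ = Dφ₀` for the change of coordinates `τ = φ₀ ∘ φ₁⁻¹`. -/
lemma fderiv_transition_chartD [IsManifold J 1 M] {p₀ p₁ p : M}
    (hp₀ : p ∈ (extChartAt J p₀).source) (hp₁ : p ∈ (extChartAt J p₁).source) (u : F) :
    fderiv ℝ (transition J p₀ p₁) (extChartAt J p₁ p) (chartD J p₁ p u) = chartD J p₀ p u := by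
  have h1 : MDifferentiableAt 𝓘(ℝ, F) J (extChartAt J p₁).symm (extChartAt J p₁ p) := by
    have := mdifferentiableWithinAt_extChartAt_symm ((extChartAt J p₁).map_source hp₁)
    rwa [J.range_eq_univ, mdifferentiableWithinAt_univ] at this
  have h2 : MDifferentiableAt J 𝓘(ℝ, F) (extChartAt J p₀)
      ((extChartAt J p₁).symm (extChartAt J p₁ p)) := by
    rw [(extChartAt J p₁).left_inv hp₁]
    exact mdifferentiableAt_extChartAt (by simpa using hp₀)
  have h3 := mfderiv_comp (extChartAt J p₁ p) h2 h1
  rw [mfderiv_eq_fderiv] at h3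
  have h4 : fderiv ℝ (transition J p₀ p₁) (extChartAt J p₁ p) =
      (chartD J p₀ ((extChartAt J p₁).symm (extChartAt J p₁ p))).comp
        (chartDSymm J p₁ (extChartAt J p₁ p)) := h3
  rw [h4, (extChartAt J p₁).left_inv hp₁]
  exact congrArg (chartD J p₀ p) (DFunLike.congr_fun (chartDSymm_comp_chartD J hp₁) u)

/-- Membership in the source of a second chart is an open condition on the first chart's values. -/
lemma eventually_extChartAt_symm_mem {p₀ p₁ p : M}
    (hp₀ : p ∈ (extChartAt J p₀).source) (hp₁ : p ∈ (extChartAt J p₁).source) :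
    ∀ᶠ x in nhds (extChartAt J p₁ p), x ∈ (extChartAt J p₁).target ∧
      (extChartAt J p₁).symm x ∈ (extChartAt J p₀).source := by
  have hx := (extChartAt J p₁).map_source hp₁
  refine Filter.Eventually.and (extChartAt_target_mem_nhds' hx) ?_
  refine (continuousAt_extChartAt_symm'' hx).eventually_mem ?_
  rw [(extChartAt J p₁).left_inv hp₁]
  exact extChartAt_source_mem_nhds' hp₀

/-- The transformation rule of the components of a vector field under a change of coordinates. -/
lemma fieldInChart_transition [IsManifold J 1 M] (Y : VField J M) {p₀ p₁ p : M}
    (hp₀ : p ∈ (extChartAt J p₀).source) (hp₁ : p ∈ (extChartAt J p₁).source) :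
    fieldInChart J Y p₀ (transition J p₀ p₁ (extChartAt J p₁ p)) =
      fderiv ℝ (transition J p₀ p₁) (extChartAt J p₁ p)
        (fieldInChart J Y p₁ (extChartAt J p₁ p)) := by
  rw [transition_extChartAt J hp₁, fieldInChart_extChartAt J Y hp₀,
    fieldInChart_extChartAt J Y hp₁]
  exact (fderiv_transition_chartD J hp₀ hp₁ (Y p)).symm

end Transition

/-! ### Bundle coordinates on the tangent bundle -/

section TangentCharts

variable {E : Type*} [NormedAddCommGroup E] [NormedSpace ℝ E]
  {Q : Type*} [TopologicalSpace Q] [ChartedSpace E Q] [IsManifold 𝓘(ℝ, E) ∞ Q]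

lemma mem_tangent_extChartAt_source {v₀ v : TangentBundle 𝓘(ℝ, E) Q} :
    v ∈ (extChartAt 𝓘(ℝ, E).tangent v₀).source ↔
      v.proj ∈ (extChartAt 𝓘(ℝ, E) v₀.proj).source := by
  simp only [extChartAt_source]
  exact TangentBundle.mem_chart_source_iff v v₀

/-- The bundle coordinates `(q, q̇)` induced by the preferred chart at `v₀.proj`. -/
lemma tangent_extChartAt_apply {v₀ v : TangentBundle 𝓘(ℝ, E) Q}
    (hv : v.proj ∈ (extChartAt 𝓘(ℝ, E) v₀.proj).source) :
    extChartAt 𝓘(ℝ, E).tangent v₀ v =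
      (extChartAt 𝓘(ℝ, E) v₀.proj v.proj, chartD 𝓘(ℝ, E) v₀.proj v.proj v.snd) := by
  have h := FiberBundle.extChartAt (F := E) (E := (TangentSpace 𝓘(ℝ, E) : Q → Type _))
    (IB := 𝓘(ℝ, E)) v₀
  have h2 : extChartAt 𝓘(ℝ, E).tangent v₀ v = ((extChartAt 𝓘(ℝ, E) v₀.proj v.proj,
      (trivializationAt E (TangentSpace 𝓘(ℝ, E)) v₀.proj v).2) : E × E) :=
    congrArg (fun e => e v) h
  rw [h2]
  exact congrArg _ (trivializationAt_snd_eq_chartD 𝓘(ℝ, E) hv v.snd)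

lemma mem_tangent_extChartAt_target {v₀ : TangentBundle 𝓘(ℝ, E) Q} {z : E × E} :
    z ∈ (extChartAt 𝓘(ℝ, E).tangent v₀).target ↔ z.1 ∈ (extChartAt 𝓘(ℝ, E) v₀.proj).target := by
  have h := FiberBundle.extChartAt_target (F := E) (E := (TangentSpace 𝓘(ℝ, E) : Q → Type _))
    (IB := 𝓘(ℝ, E)) v₀
  have h2 : z ∈ (extChartAt 𝓘(ℝ, E).tangent v₀).target ↔ z ∈
    ((extChartAt 𝓘(ℝ, E) v₀.proj).target ∩ (extChartAt 𝓘(ℝ, E) v₀.proj).symm ⁻¹'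
      (trivializationAt E (TangentSpace 𝓘(ℝ, E)) v₀.proj).baseSet) ×ˢ Set.univ :=
    (Set.ext_iff.1 h z)
  rw [h2]
  simp only [Set.mem_prod, Set.mem_inter_iff, Set.mem_univ, and_true, Set.mem_preimage]
  refine ⟨fun h => h.1, fun h => ⟨h, ?_⟩⟩
  have := (extChartAt 𝓘(ℝ, E) v₀.proj).map_target h
  rw [extChartAt_source] at this
  exact this

lemma tangent_extChartAt_symm_proj {v₀ : TangentBundle 𝓘(ℝ, E) Q} {z : E × E}
    (hz : z.1 ∈ (extChartAt 𝓘(ℝ, E) v₀.proj).target) :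
    ((extChartAt 𝓘(ℝ, E).tangent v₀).symm z).proj =
      (extChartAt 𝓘(ℝ, E) v₀.proj).symm z.1 := by
  have hz' : z ∈ (extChartAt 𝓘(ℝ, E).tangent v₀).target := mem_tangent_extChartAt_target.2 hz
  have h1 := mem_tangent_extChartAt_source.1
    ((extChartAt 𝓘(ℝ, E).tangent v₀).map_target hz')
  have h2 := tangent_extChartAt_apply h1
  have h3 : extChartAt 𝓘(ℝ, E) v₀.proj ((extChartAt 𝓘(ℝ, E).tangent v₀).symm z).proj = z.1 :=
    (congrArg Prod.fst h2).symm.trans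
      (congrArg Prod.fst ((extChartAt 𝓘(ℝ, E).tangent v₀).right_inv hz'))
  rw [← h3, (extChartAt 𝓘(ℝ, E) v₀.proj).left_inv h1]

/-- `Tτ_Q` is the projection on the first factor in bundle coordinates. -/
lemma chartD_dProj {v₀ v : TangentBundle 𝓘(ℝ, E) Q}
    (hv : v.proj ∈ (extChartAt 𝓘(ℝ, E) v₀.proj).source) (u : TangentSpace 𝓘(ℝ, E).tangent v) :
    chartD 𝓘(ℝ, E) v₀.proj v.proj (dProj v u) = (chartD 𝓘(ℝ, E).tangent v₀ v u).1 := by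
  have hvs := mem_tangent_extChartAt_source.2 hv
  have h1 : HasMFDerivAt 𝓘(ℝ, E) 𝓘(ℝ, E) (extChartAt 𝓘(ℝ, E) v₀.proj) v.proj
      (chartD (F := E) 𝓘(ℝ, E) v₀.proj v.proj) :=
    (mdifferentiableAt_extChartAt (by simpa using hv)).hasMFDerivAt
  have h2 : HasMFDerivAt 𝓘(ℝ, E).tangent 𝓘(ℝ, E)
      (fun w : TangentBundle 𝓘(ℝ, E) Q => w.proj) v (dProj v) :=
    ((Bundle.contMDiff_proj (n := 1) (TangentSpace 𝓘(ℝ, E))).mdifferentiable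
      one_ne_zero v).hasMFDerivAt
  have h3 : HasMFDerivAt 𝓘(ℝ, E).tangent 𝓘(ℝ, E × E)
      (extChartAt 𝓘(ℝ, E).tangent v₀) v
      (chartD (F := E × E) 𝓘(ℝ, E).tangent v₀ v) :=
    (mdifferentiableAt_extChartAt (by simpa using hvs)).hasMFDerivAt
  have h4 := (hasFDerivAt_fst (𝕜 := ℝ) (E := E) (F := E)
    (p := extChartAt 𝓘(ℝ, E).tangent v₀ v)).hasMFDerivAt.comp v h3
  have h5 := (h1.comp v h2).congr_of_eventuallyEq (f₁ :=
    Prod.fst ∘ extChartAt 𝓘(ℝ, E).tangent v₀) (by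
      filter_upwards [extChartAt_source_mem_nhds' hvs] with w hw
      exact congrArg Prod.fst (tangent_extChartAt_apply (mem_tangent_extChartAt_source.1 hw)))
  exact DFunLike.congr_fun (hasMFDerivAt_unique h5 h4) u

lemma contMDiff_fibre_inclusion (q : Q) :
    ContMDiff 𝓘(ℝ, E) 𝓘(ℝ, E).tangent ∞ (fun w : E => (⟨q, w⟩ : TangentBundle 𝓘(ℝ, E) Q)) := by
  intro w
  refine (Bundle.contMDiffAt_totalSpace ..).2 ⟨contMDiffAt_const, ?_⟩
  refine contMDiffAt_id.congr_of_eventuallyEq (Filter.Eventually.of_forall fun w' => ?_)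
  have h := trivializationAt_snd_eq_chartD 𝓘(ℝ, E) (mem_extChartAt_source (I := 𝓘(ℝ, E)) q) w'
  rw [chartD_self] at h
  exact h

/-- The vertical lift is the inclusion of the second factor in bundle coordinates. -/
lemma chartD_vertLift {v₀ v : TangentBundle 𝓘(ℝ, E) Q}
    (hv : v.proj ∈ (extChartAt 𝓘(ℝ, E) v₀.proj).source) (w : E) :
    chartD 𝓘(ℝ, E).tangent v₀ v (vertLift v w) = (0, chartD 𝓘(ℝ, E) v₀.proj v.proj w) := by
  have hvs := mem_tangent_extChartAt_source.2 hv
  have h2 : HasMFDerivAt 𝓘(ℝ, E) 𝓘(ℝ, E).tangent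
      (fun w : E => (⟨v.proj, w⟩ : TangentBundle 𝓘(ℝ, E) Q)) v.snd (vertLift v) :=
    ((contMDiff_fibre_inclusion (E := E) v.proj).mdifferentiable (by simp) v.snd).hasMFDerivAt
  have h3 : HasMFDerivAt 𝓘(ℝ, E).tangent 𝓘(ℝ, E × E)
      (extChartAt 𝓘(ℝ, E).tangent v₀) v
      (chartD (F := E × E) 𝓘(ℝ, E).tangent v₀ v) :=
    (mdifferentiableAt_extChartAt (by simpa using hvs)).hasMFDerivAt
  have h4 := HasMFDerivAt.comp (x := (v.snd : E)) (g := extChartAt 𝓘(ℝ, E).tangent v₀)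
    (f := fun w : E => (⟨v.proj, w⟩ : TangentBundle 𝓘(ℝ, E) Q)) h3 h2
  have h5 : HasFDerivAt (fun w : E => (extChartAt 𝓘(ℝ, E) v₀.proj v.proj,
      chartD 𝓘(ℝ, E) v₀.proj v.proj w))
      (ContinuousLinearMap.prod 0 (chartD (F := E) 𝓘(ℝ, E) v₀.proj v.proj)) (v.snd : E) :=
    (hasFDerivAt_const _ _).prodMk (chartD (F := E) 𝓘(ℝ, E) v₀.proj v.proj).hasFDerivAt
  have h6 : (fun w : E => (extChartAt 𝓘(ℝ, E) v₀.proj v.proj,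
      chartD 𝓘(ℝ, E) v₀.proj v.proj w)) = (extChartAt 𝓘(ℝ, E).tangent v₀) ∘
        fun w : E => (⟨v.proj, w⟩ : TangentBundle 𝓘(ℝ, E) Q) := by
    funext w'
    exact (tangent_extChartAt_apply (v := ⟨v.proj, w'⟩) hv).symm
  rw [h6] at h5
  exact DFunLike.congr_fun (hasMFDerivAt_unique h4 h5.hasMFDerivAt) w

lemma chartD_vertEndo {v₀ v : TangentBundle 𝓘(ℝ, E) Q}
    (hv : v.proj ∈ (extChartAt 𝓘(ℝ, E) v₀.proj).source) (u : TangentSpace 𝓘(ℝ, E).tangent v) :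
    chartD 𝓘(ℝ, E).tangent v₀ v (vertEndo v u) = (0, (chartD 𝓘(ℝ, E).tangent v₀ v u).1) := by
  exact (chartD_vertLift (E := E) hv (dProj v u)).trans
    (congrArg (Prod.mk 0) (chartD_dProj (E := E) hv u))

lemma dProj_apply (v : TangentBundle 𝓘(ℝ, E) Q) (u : E × E) : dProj v u = u.1 := by
  have h := chartD_dProj (mem_extChartAt_source (I := 𝓘(ℝ, E)) v.proj) u
  rw [chartD_self, chartD_self] at h
  exact h

lemma vertLift_apply (v : TangentBundle 𝓘(ℝ, E) Q) (w : E) : vertLift v w = ((0, w) : E × E) := by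
  have h := chartD_vertLift (mem_extChartAt_source (I := 𝓘(ℝ, E)) v.proj) w
  rw [chartD_self, chartD_self] at h
  exact h

/-- The complete lift at `v` in the chart centred at `v`, whose derivative at `v` is the identity of
`E × E`. -/
lemma cLift_apply (X : VField 𝓘(ℝ, E) Q) (v : TangentBundle 𝓘(ℝ, E) Q) :
    cLift X v = ((X v.proj, fderiv ℝ (fieldInChart 𝓘(ℝ, E) X v.proj)
      (extChartAt 𝓘(ℝ, E) v.proj v.proj) v.snd) : E × E) := by
  have h : cLift X v = (chartD 𝓘(ℝ, E).tangent v v).inverse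
      (fieldInChart 𝓘(ℝ, E) X v.proj (extChartAt 𝓘(ℝ, E) v.proj v.proj),
        fderiv ℝ (fieldInChart 𝓘(ℝ, E) X v.proj) (extChartAt 𝓘(ℝ, E) v.proj v.proj)
          (chartD 𝓘(ℝ, E) v.proj v.proj v.snd)) := rfl
  rw [h, chartD_self, ContinuousLinearMap.inverse_id, fieldInChart_extChartAt _ _
    (mem_extChartAt_source (I := 𝓘(ℝ, E)) v.proj), chartD_self]
  rfl

/-- A change of bundle coordinates acts on velocities by the derivative of the change of coordinates
on the base. -/
lemma tangent_transition_apply {v₀ v₁ r : TangentBundle 𝓘(ℝ, E) Q}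
    (h₀ : r.proj ∈ (extChartAt 𝓘(ℝ, E) v₀.proj).source)
    (h₁ : r.proj ∈ (extChartAt 𝓘(ℝ, E) v₁.proj).source) {z : E × E}
    (hz : extChartAt 𝓘(ℝ, E).tangent v₁ r = z) :
    transition 𝓘(ℝ, E).tangent v₀ v₁ z =
      (transition 𝓘(ℝ, E) v₀.proj v₁.proj z.1,
        fderiv ℝ (transition 𝓘(ℝ, E) v₀.proj v₁.proj) z.1 z.2) := by
  subst hz
  rw [transition_extChartAt _ (mem_tangent_extChartAt_source.2 h₁), tangent_extChartAt_apply h₀,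
    tangent_extChartAt_apply h₁]
  exact Prod.ext (transition_extChartAt _ h₁).symm
    (fderiv_transition_chartD (F := E) 𝓘(ℝ, E) h₀ h₁ r.snd).symm

/-- In every system of bundle coordinates, `X^c = Xⁱ ∂/∂qⁱ + q̇ʲ (∂Xⁱ/∂qʲ) ∂/∂q̇ⁱ`. The second
derivative of the change of coordinates enters twice, with its arguments exchanged. -/
lemma chartD_cLift {X : VField 𝓘(ℝ, E) Q} (hX : SmoothVField 𝓘(ℝ, E) X)
    {v₀ v : TangentBundle 𝓘(ℝ, E) Q} (hv : v.proj ∈ (extChartAt 𝓘(ℝ, E) v₀.proj).source) :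
    chartD 𝓘(ℝ, E).tangent v₀ v (cLift X v) =
      (fieldInChart 𝓘(ℝ, E) X v₀.proj (extChartAt 𝓘(ℝ, E).tangent v₀ v).1,
        fderiv ℝ (fieldInChart 𝓘(ℝ, E) X v₀.proj) (extChartAt 𝓘(ℝ, E).tangent v₀ v).1
          (extChartAt 𝓘(ℝ, E).tangent v₀ v).2) := by
  have hvs := mem_tangent_extChartAt_source.2 hv
  have hq := mem_extChartAt_source (I := 𝓘(ℝ, E)) v.proj
  set q₀ := v₀.proj
  set q := v.proj
  set x := extChartAt 𝓘(ℝ, E) q q with hx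
  let y : E := v.snd
  set τ := transition 𝓘(ℝ, E) q₀ q with hτ
  set X₀ := fieldInChart 𝓘(ℝ, E) X q₀
  set X₁ := fieldInChart 𝓘(ℝ, E) X q
  have hτs : ContDiffAt ℝ ∞ τ x := contDiffAt_transition 𝓘(ℝ, E) hv hq
  have hDτ : DifferentiableAt ℝ (fderiv ℝ τ) x :=
    (hτs.fderiv_right (m := 1) (by norm_cast)).differentiableAt one_ne_zero
  have hX₁ : DifferentiableAt ℝ X₁ x :=
    (((contDiffOn_fieldInChart 𝓘(ℝ, E) hX q).contDiffAt
      (extChartAt_target_mem_nhds' ((extChartAt 𝓘(ℝ, E) q).map_source hq)))).differentiableAt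
      (by simp)
  have hτx : τ x = extChartAt 𝓘(ℝ, E) q₀ q := transition_extChartAt 𝓘(ℝ, E) hq
  have hX₀ : DifferentiableAt ℝ X₀ (τ x) := by
    rw [hτx]
    exact (((contDiffOn_fieldInChart 𝓘(ℝ, E) hX q₀).contDiffAt
      (extChartAt_target_mem_nhds' ((extChartAt 𝓘(ℝ, E) q₀).map_source hv)))).differentiableAt
      (by simp)
  have hDτx : fderiv ℝ τ x = chartD 𝓘(ℝ, E) q₀ q := by
    ext u
    have := fderiv_transition_chartD 𝓘(ℝ, E) hv hq u
    rwa [chartD_self] at this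
  have hev := eventually_extChartAt_symm_mem 𝓘(ℝ, E) hv hq
  -- the transformation rule of `X`, differentiated
  have hrule : X₀ ∘ τ =ᶠ[nhds x] fun x' => fderiv ℝ τ x' (X₁ x') := by
    filter_upwards [hev] with x' hx'
    have := fieldInChart_transition 𝓘(ℝ, E) X hx'.2 ((extChartAt 𝓘(ℝ, E) q).map_target hx'.1)
    rwa [(extChartAt 𝓘(ℝ, E) q).right_inv hx'.1] at this
  have hd1 := hX₀.hasFDerivAt.comp x (hτs.differentiableAt (by simp)).hasFDerivAt
  have hd2 := (hDτ.hasFDerivAt.clm_apply hX₁.hasFDerivAt).congr_of_eventuallyEq hrule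
  have hd3 := DFunLike.congr_fun (hd1.unique hd2) y
  simp only [ContinuousLinearMap.comp_apply, add_apply,
    ContinuousLinearMap.flip_apply] at hd3
  -- the change of bundle coordinates, differentiated
  have hT : transition 𝓘(ℝ, E).tangent v₀ v =ᶠ[nhds (x, y)]
      fun z => (τ z.1, fderiv ℝ τ z.1 z.2) := by
    filter_upwards [(continuous_fst.tendsto (x, y)).eventually hev] with z hz
    have hr := tangent_extChartAt_symm_proj (v₀ := v) hz.1
    refine tangent_transition_apply (r := (extChartAt 𝓘(ℝ, E).tangent v).symm z) ?_ ?_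
      ((extChartAt 𝓘(ℝ, E).tangent v).right_inv (mem_tangent_extChartAt_target.2 hz.1))
    · rw [hr]; exact hz.2
    · rw [hr]; exact (extChartAt 𝓘(ℝ, E) q).map_target hz.1
  have hT1 : HasFDerivAt (fun z : E × E => τ z.1)
      ((fderiv ℝ τ x).comp (ContinuousLinearMap.fst ℝ E E)) (x, y) :=
    HasFDerivAt.comp (g := τ) (f := Prod.fst) (x, y)
      (hτs.differentiableAt (by simp)).hasFDerivAt hasFDerivAt_fst
  have hT2 : HasFDerivAt (fun z : E × E => fderiv ℝ τ z.1)
      ((fderiv ℝ (fderiv ℝ τ) x).comp (ContinuousLinearMap.fst ℝ E E)) (x, y) :=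
    HasFDerivAt.comp (g := fderiv ℝ τ) (f := Prod.fst) (x, y) hDτ.hasFDerivAt hasFDerivAt_fst
  have hT3 := ((hT1.prodMk (hT2.clm_apply hasFDerivAt_snd)).congr_of_eventuallyEq hT).fderiv
  have hv' : extChartAt 𝓘(ℝ, E).tangent v v = (x, y) := by
    rw [tangent_extChartAt_apply hq, chartD_self]
    rfl
  have hcD : chartD 𝓘(ℝ, E).tangent v₀ v (cLift X v) =
      fderiv ℝ (transition 𝓘(ℝ, E).tangent v₀ v) (x, y) (X₁ x, fderiv ℝ X₁ x y) := by
    have h1 := fderiv_transition_chartD (F := E × E) 𝓘(ℝ, E).tangent hvs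
      (mem_extChartAt_source (I := 𝓘(ℝ, E).tangent) v) (cLift X v)
    rw [chartD_self, hv'] at h1
    rw [← h1]
    have hX1 : X₁ x = chartD 𝓘(ℝ, E) q q (X q) := fieldInChart_extChartAt 𝓘(ℝ, E) X hq
    rw [hX1, chartD_self]
    exact congrArg _ (cLift_apply X v)
  have hv₀ : extChartAt 𝓘(ℝ, E).tangent v₀ v = (τ x, fderiv ℝ τ x y) := by
    rw [tangent_extChartAt_apply hv, hτx, hDτx]
  have hsymm := (hτs.isSymmSndFDerivAt
    (by rw [minSmoothness_of_isRCLikeNormedField]; norm_cast)).eq (X₁ x) y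
  rw [hcD, hT3, hv₀]
  refine Prod.ext ?_ ?_
  · exact hrule.eq_of_nhds.symm
  · simp only [ContinuousLinearMap.prod_apply, add_apply, ContinuousLinearMap.comp_apply,
      ContinuousLinearMap.flip_apply, ContinuousLinearMap.coe_fst', ContinuousLinearMap.coe_snd']
    rw [hd3, hsymm]

end TangentCharts

/-! ### The Poincaré–Cartan forms and the energy in bundle coordinates -/

/-- A nondegenerate bilinear form on a finite-dimensional space is an isomorphism onto the dual. -/
lemma isInvertible_of_nondegenerate {G : Type*} [NormedAddCommGroup G] [NormedSpace ℝ G]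
    [FiniteDimensional ℝ G] {A : G →L[ℝ] G →L[ℝ] ℝ} (hA : ∀ u, A u = 0 → u = 0) :
    A.IsInvertible := by
  have hinj : Function.Injective (A : G →ₗ[ℝ] G →L[ℝ] ℝ) :=
    (injective_iff_map_eq_zero _).2 hA
  have hrank : Module.finrank ℝ G = Module.finrank ℝ (G →L[ℝ] ℝ) := by
    rw [← Subspace.dual_finrank_eq (K := ℝ) (V := G)]
    exact (LinearMap.toContinuousLinearMap (𝕜 := ℝ) (E := G) (F' := ℝ)).finrank_eq
  exact ⟨(LinearEquiv.ofInjectiveOfFinrankEq _ hinj hrank).toContinuousLinearEquiv, by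
    ext; rfl⟩

section Coordinates

variable {E : Type*} [NormedAddCommGroup E] [NormedSpace ℝ E]
  {Q : Type*} [TopologicalSpace Q] [ChartedSpace E Q] [IsManifold 𝓘(ℝ, E) ∞ Q]

/-- The Lagrangian in the bundle coordinates `(q, q̇)` around `v₀`. -/
def localLagrangian (L : TangentBundle 𝓘(ℝ, E) Q → ℝ) (v₀ : TangentBundle 𝓘(ℝ, E) Q) :
    E × E → ℝ :=
  L ∘ (extChartAt 𝓘(ℝ, E).tangent v₀).symm

/-- The bundle coordinates of the point `v` in the chart centred at `v` itself. -/
lemma tangent_extChartAt_self (v : TangentBundle 𝓘(ℝ, E) Q) :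
    extChartAt 𝓘(ℝ, E).tangent v v = (extChartAt 𝓘(ℝ, E) v.proj v.proj, v.snd) := by
  rw [tangent_extChartAt_apply (mem_extChartAt_source (I := 𝓘(ℝ, E)) v.proj), chartD_self]
  rfl

lemma contDiffAt_localLagrangian {L : TangentBundle 𝓘(ℝ, E) Q → ℝ}
    (hL : ContMDiff 𝓘(ℝ, E).tangent 𝓘(ℝ, ℝ) ∞ L) {v₀ : TangentBundle 𝓘(ℝ, E) Q} {z : E × E}
    (hz : z ∈ (extChartAt 𝓘(ℝ, E).tangent v₀).target) :
    ContDiffAt ℝ ∞ (localLagrangian L v₀) z :=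
  (contDiffOn_comp_chart_symm 𝓘(ℝ, E).tangent hL v₀).contDiffAt (extChartAt_target_mem_nhds' hz)

lemma differentiableAt_fderiv_localLagrangian {L : TangentBundle 𝓘(ℝ, E) Q → ℝ}
    (hL : ContMDiff 𝓘(ℝ, E).tangent 𝓘(ℝ, ℝ) ∞ L) {v₀ : TangentBundle 𝓘(ℝ, E) Q} {z : E × E}
    (hz : z ∈ (extChartAt 𝓘(ℝ, E).tangent v₀).target) :
    DifferentiableAt ℝ (fderiv ℝ (localLagrangian L v₀)) z :=
  ((contDiffAt_localLagrangian hL hz).fderiv_right (m := 1) (by norm_cast)).differentiableAt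
    one_ne_zero

lemma fderiv_fderiv_localLagrangian_symm {L : TangentBundle 𝓘(ℝ, E) Q → ℝ}
    (hL : ContMDiff 𝓘(ℝ, E).tangent 𝓘(ℝ, ℝ) ∞ L) (v : TangentBundle 𝓘(ℝ, E) Q) (u w : E × E) :
    fderiv ℝ (fderiv ℝ (localLagrangian L v)) (extChartAt 𝓘(ℝ, E).tangent v v) u w =
      fderiv ℝ (fderiv ℝ (localLagrangian L v)) (extChartAt 𝓘(ℝ, E).tangent v v) w u :=
  ((contDiffAt_localLagrangian hL (mem_extChartAt_target v)).isSymmSndFDerivAt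
    (by rw [minSmoothness_of_isRCLikeNormedField]; norm_cast)).eq u w

lemma dFun_lagrangian {L : TangentBundle 𝓘(ℝ, E) Q → ℝ}
    (hL : ContMDiff 𝓘(ℝ, E).tangent 𝓘(ℝ, ℝ) ∞ L) {v₀ v : TangentBundle 𝓘(ℝ, E) Q}
    (hv : v ∈ (extChartAt 𝓘(ℝ, E).tangent v₀).source) (u : E × E) :
    dFun 𝓘(ℝ, E).tangent L v u = fderiv ℝ (localLagrangian L v₀)
      (extChartAt 𝓘(ℝ, E).tangent v₀ v) (chartD 𝓘(ℝ, E).tangent v₀ v u) :=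
  dFun_eq_fderiv_comp_chartD 𝓘(ℝ, E).tangent hL hv u

lemma dFun_lagrangian_self {L : TangentBundle 𝓘(ℝ, E) Q → ℝ}
    (hL : ContMDiff 𝓘(ℝ, E).tangent 𝓘(ℝ, ℝ) ∞ L) (v : TangentBundle 𝓘(ℝ, E) Q) (u : E × E) :
    dFun 𝓘(ℝ, E).tangent L v u =
      fderiv ℝ (localLagrangian L v) (extChartAt 𝓘(ℝ, E).tangent v v) u := by
  rw [dFun_lagrangian hL (mem_extChartAt_source v), chartD_self]
  rfl

/-- `α_L = (∂L/∂q̇ⁱ) dqⁱ` in bundle coordinates. -/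
lemma formInChart_alphaForm {L : TangentBundle 𝓘(ℝ, E) Q → ℝ}
    (hL : ContMDiff 𝓘(ℝ, E).tangent 𝓘(ℝ, ℝ) ∞ L) {v₀ : TangentBundle 𝓘(ℝ, E) Q} {z : E × E}
    (hz : z ∈ (extChartAt 𝓘(ℝ, E).tangent v₀).target) :
    formInChart 𝓘(ℝ, E).tangent (alphaForm L) v₀ z =
      (fderiv ℝ (localLagrangian L v₀) z).comp
        ((ContinuousLinearMap.inr ℝ E E).comp (ContinuousLinearMap.fst ℝ E E)) := by
  refine ContinuousLinearMap.ext fun w => ?_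
  obtain ⟨u, hu, h⟩ := formInChart_apply 𝓘(ℝ, E).tangent (alphaForm L) hz w
  have hs := (extChartAt 𝓘(ℝ, E).tangent v₀).map_target hz
  have h1 := dFun_lagrangian hL hs
    (vertEndo ((extChartAt 𝓘(ℝ, E).tangent v₀).symm z) u)
  have h2 := chartD_vertEndo (mem_tangent_extChartAt_source.1 hs) u
  rw [h2, (extChartAt 𝓘(ℝ, E).tangent v₀).right_inv hz, hu] at h1
  exact h.trans h1

lemma hasFDerivAt_formInChart_alphaForm {L : TangentBundle 𝓘(ℝ, E) Q → ℝ}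
    (hL : ContMDiff 𝓘(ℝ, E).tangent 𝓘(ℝ, ℝ) ∞ L) (v : TangentBundle 𝓘(ℝ, E) Q) :
    HasFDerivAt (formInChart 𝓘(ℝ, E).tangent (alphaForm L) v)
      ((ContinuousLinearMap.precomp ℝ
        ((ContinuousLinearMap.inr ℝ E E).comp (ContinuousLinearMap.fst ℝ E E))).comp
        (fderiv ℝ (fderiv ℝ (localLagrangian L v)) (extChartAt 𝓘(ℝ, E).tangent v v)))
      (extChartAt 𝓘(ℝ, E).tangent v v) := by
  have h1 := (differentiableAt_fderiv_localLagrangian hL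
    (mem_extChartAt_target (I := 𝓘(ℝ, E).tangent) v)).hasFDerivAt
  refine ((ContinuousLinearMap.precomp ℝ ((ContinuousLinearMap.inr ℝ E E).comp
    (ContinuousLinearMap.fst ℝ E E))).hasFDerivAt.comp _ h1).congr_of_eventuallyEq ?_
  filter_upwards [extChartAt_target_mem_nhds (I := 𝓘(ℝ, E).tangent) v] with z hz
  exact formInChart_alphaForm hL hz

lemma extDerivForm_alphaForm {L : TangentBundle 𝓘(ℝ, E) Q → ℝ}
    (hL : ContMDiff 𝓘(ℝ, E).tangent 𝓘(ℝ, ℝ) ∞ L) (v : TangentBundle 𝓘(ℝ, E) Q) (u w : E × E) :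
    extDerivForm 𝓘(ℝ, E).tangent (alphaForm L) v u w =
      fderiv ℝ (fderiv ℝ (localLagrangian L v)) (extChartAt 𝓘(ℝ, E).tangent v v) u (0, w.1) -
      fderiv ℝ (fderiv ℝ (localLagrangian L v)) (extChartAt 𝓘(ℝ, E).tangent v v) w (0, u.1) := by
  have h := extDerivForm_apply 𝓘(ℝ, E).tangent (alphaForm L) v u w
  rw [(hasFDerivAt_formInChart_alphaForm hL v).fderiv] at h
  exact h

lemma omegaForm_apply {L : TangentBundle 𝓘(ℝ, E) Q → ℝ}
    (hL : ContMDiff 𝓘(ℝ, E).tangent 𝓘(ℝ, ℝ) ∞ L) (v : TangentBundle 𝓘(ℝ, E) Q) (u w : E × E) :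
    omegaForm L v u w =
      fderiv ℝ (fderiv ℝ (localLagrangian L v)) (extChartAt 𝓘(ℝ, E).tangent v v) w (0, u.1) -
      fderiv ℝ (fderiv ℝ (localLagrangian L v)) (extChartAt 𝓘(ℝ, E).tangent v v) u (0, w.1) := by
  have h : omegaForm L v u w = -extDerivForm 𝓘(ℝ, E).tangent (alphaForm L) v u w := rfl
  rw [h, extDerivForm_alphaForm hL v u w]
  ring

/-- `X^v(L) = Xⁱ ∂L/∂q̇ⁱ` in bundle coordinates. -/
lemma vLift_lagrangian_eventuallyEq {L : TangentBundle 𝓘(ℝ, E) Q → ℝ}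
    (hL : ContMDiff 𝓘(ℝ, E).tangent 𝓘(ℝ, ℝ) ∞ L) (X : VField 𝓘(ℝ, E) Q)
    (v₀ : TangentBundle 𝓘(ℝ, E) Q) :
    (fun v => dFun 𝓘(ℝ, E).tangent L v (vLift X v)) =ᶠ[nhds v₀]
      (fun z => fderiv ℝ (localLagrangian L v₀) z
        (0, fieldInChart 𝓘(ℝ, E) X v₀.proj z.1)) ∘ extChartAt 𝓘(ℝ, E).tangent v₀ := by
  filter_upwards [extChartAt_source_mem_nhds (I := 𝓘(ℝ, E).tangent) v₀] with v hv
  have hq := mem_tangent_extChartAt_source.1 hv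
  have h1 := dFun_lagrangian hL hv (vLift X v)
  have h2 : chartD 𝓘(ℝ, E).tangent v₀ v (vLift X v) =
      (0, chartD 𝓘(ℝ, E) v₀.proj v.proj (X v.proj)) := chartD_vertLift (E := E) hq (X v.proj)
  rw [h2] at h1
  refine h1.trans (congrArg (fun b => fderiv ℝ (localLagrangian L v₀)
    (extChartAt 𝓘(ℝ, E).tangent v₀ v) ((0, b) : E × E)) ?_)
  rw [tangent_extChartAt_apply hq]
  exact (fieldInChart_extChartAt 𝓘(ℝ, E) X hq).symm

/-- `E_L = q̇ⁱ ∂L/∂q̇ⁱ - L` in bundle coordinates. -/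
lemma energy_eventuallyEq {L : TangentBundle 𝓘(ℝ, E) Q → ℝ}
    (hL : ContMDiff 𝓘(ℝ, E).tangent 𝓘(ℝ, ℝ) ∞ L) (v₀ : TangentBundle 𝓘(ℝ, E) Q) :
    energy L =ᶠ[nhds v₀] (fun z => fderiv ℝ (localLagrangian L v₀) z (0, z.2) -
      localLagrangian L v₀ z) ∘ extChartAt 𝓘(ℝ, E).tangent v₀ := by
  filter_upwards [extChartAt_source_mem_nhds (I := 𝓘(ℝ, E).tangent) v₀] with v hv
  have hq := mem_tangent_extChartAt_source.1 hv
  have h1 := dFun_lagrangian hL hv (liouville v)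
  have h2 : chartD 𝓘(ℝ, E).tangent v₀ v (liouville v) =
      (0, chartD 𝓘(ℝ, E) v₀.proj v.proj v.snd) := chartD_vertLift (E := E) hq v.snd
  have h3 : (extChartAt 𝓘(ℝ, E).tangent v₀ v).2 = chartD 𝓘(ℝ, E) v₀.proj v.proj v.snd :=
    congrArg Prod.snd (tangent_extChartAt_apply hq)
  rw [h2, ← h3] at h1
  have h4 : localLagrangian L v₀ (extChartAt 𝓘(ℝ, E).tangent v₀ v) = L v :=
    congrArg L ((extChartAt 𝓘(ℝ, E).tangent v₀).left_inv hv)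
  exact congrArg₂ (· - ·) h1 h4.symm

lemma dFun_energy {L : TangentBundle 𝓘(ℝ, E) Q → ℝ}
    (hL : ContMDiff 𝓘(ℝ, E).tangent 𝓘(ℝ, ℝ) ∞ L) (v : TangentBundle 𝓘(ℝ, E) Q) (u : E × E) :
    dFun 𝓘(ℝ, E).tangent (energy L) v u =
      fderiv ℝ (fderiv ℝ (localLagrangian L v)) (extChartAt 𝓘(ℝ, E).tangent v v) u
        (0, (extChartAt 𝓘(ℝ, E).tangent v v).2) -
        fderiv ℝ (localLagrangian L v) (extChartAt 𝓘(ℝ, E).tangent v v) (u.1, 0) := by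
  have hz := mem_extChartAt_target (I := 𝓘(ℝ, E).tangent) v
  have h0 := ((contDiffAt_localLagrangian hL hz).differentiableAt (by simp)).hasFDerivAt
  have h1 := (differentiableAt_fderiv_localLagrangian hL hz).hasFDerivAt
  have h2 := (h1.clm_apply (((ContinuousLinearMap.inr ℝ E E).comp
    (ContinuousLinearMap.snd ℝ E E)).hasFDerivAt)).sub h0
  have h3 := dFun_eq_of_eventuallyEq_comp_chart 𝓘(ℝ, E).tangent
    (mem_extChartAt_source (I := 𝓘(ℝ, E).tangent) v) h2 (energy_eventuallyEq hL v) u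
  rw [chartD_self] at h3
  set Λ := localLagrangian L v
  set z := extChartAt 𝓘(ℝ, E).tangent v v with hzd
  have h4 : dFun 𝓘(ℝ, E).tangent (energy L) v u =
      fderiv ℝ Λ z (0, u.2) + fderiv ℝ (fderiv ℝ Λ) z u (0, z.2) - fderiv ℝ Λ z u := h3
  have h5 : fderiv ℝ Λ z u = fderiv ℝ Λ z (u.1, 0) + fderiv ℝ Λ z (0, u.2) := by
    rw [← map_add]; simp
  rw [h4, h5]
  ring

/-- The components of `X` on `Q` are smooth at the base point of `v`, written as the first bundle
coordinate of `v`. -/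
lemma contDiffAt_fieldInChart_fst {X : VField 𝓘(ℝ, E) Q} (hX : SmoothVField 𝓘(ℝ, E) X)
    (v : TangentBundle 𝓘(ℝ, E) Q) :
    ContDiffAt ℝ ∞ (fieldInChart 𝓘(ℝ, E) X v.proj) (extChartAt 𝓘(ℝ, E).tangent v v).1 := by
  rw [tangent_extChartAt_self]
  exact (contDiffOn_fieldInChart 𝓘(ℝ, E) hX v.proj).contDiffAt
    (extChartAt_target_mem_nhds (I := 𝓘(ℝ, E)) v.proj)

lemma fderiv_vLift_lagrangian {L : TangentBundle 𝓘(ℝ, E) Q → ℝ}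
    (hL : ContMDiff 𝓘(ℝ, E).tangent 𝓘(ℝ, ℝ) ∞ L) {X : VField 𝓘(ℝ, E) Q}
    (hX : SmoothVField 𝓘(ℝ, E) X) (v : TangentBundle 𝓘(ℝ, E) Q) :
    DifferentiableAt ℝ (fun z : E × E => fderiv ℝ (localLagrangian L v) z
        (0, fieldInChart 𝓘(ℝ, E) X v.proj z.1)) (extChartAt 𝓘(ℝ, E).tangent v v) ∧
    ∀ u : E × E, fderiv ℝ (fun z : E × E => fderiv ℝ (localLagrangian L v) z
        (0, fieldInChart 𝓘(ℝ, E) X v.proj z.1)) (extChartAt 𝓘(ℝ, E).tangent v v) u =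
      fderiv ℝ (fderiv ℝ (localLagrangian L v)) (extChartAt 𝓘(ℝ, E).tangent v v) u
        (0, X v.proj) +
      fderiv ℝ (localLagrangian L v) (extChartAt 𝓘(ℝ, E).tangent v v)
        (0, fderiv ℝ (fieldInChart 𝓘(ℝ, E) X v.proj) (extChartAt 𝓘(ℝ, E) v.proj v.proj) u.1) := by
  have hz := mem_extChartAt_target (I := 𝓘(ℝ, E).tangent) v
  have h1 := (differentiableAt_fderiv_localLagrangian hL hz).hasFDerivAt
  have h2 := ((contDiffAt_fieldInChart_fst hX v).differentiableAt (by simp)).hasFDerivAt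
  have h3 := HasFDerivAt.comp (f := Prod.fst) (extChartAt 𝓘(ℝ, E).tangent v v) h2 hasFDerivAt_fst
  have h4 := h1.clm_apply
    ((ContinuousLinearMap.inr ℝ E E).hasFDerivAt.comp (extChartAt 𝓘(ℝ, E).tangent v v) h3)
  refine ⟨h4.differentiableAt, fun u => ?_⟩
  have h5 := DFunLike.congr_fun h4.fderiv u
  have h6 : (extChartAt 𝓘(ℝ, E).tangent v v).1 = extChartAt 𝓘(ℝ, E) v.proj v.proj :=
    congrArg Prod.fst (tangent_extChartAt_self v)
  have h7 : fieldInChart 𝓘(ℝ, E) X v.proj (extChartAt 𝓘(ℝ, E) v.proj v.proj) = (X v.proj : E) := by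
    have := fieldInChart_extChartAt 𝓘(ℝ, E) X (mem_extChartAt_source (I := 𝓘(ℝ, E)) v.proj)
    rwa [chartD_self] at this
  rw [← h7, ← h6]
  exact h5.trans (add_comm _ _)

lemma dFun_vLift_lagrangian {L : TangentBundle 𝓘(ℝ, E) Q → ℝ}
    (hL : ContMDiff 𝓘(ℝ, E).tangent 𝓘(ℝ, ℝ) ∞ L) {X : VField 𝓘(ℝ, E) Q}
    (hX : SmoothVField 𝓘(ℝ, E) X) (v : TangentBundle 𝓘(ℝ, E) Q) (u : E × E) :
    dFun 𝓘(ℝ, E).tangent (fun v => dFun 𝓘(ℝ, E).tangent L v (vLift X v)) v u =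
      fderiv ℝ (fderiv ℝ (localLagrangian L v)) (extChartAt 𝓘(ℝ, E).tangent v v) u
        (0, X v.proj) +
      fderiv ℝ (localLagrangian L v) (extChartAt 𝓘(ℝ, E).tangent v v)
        (0, fderiv ℝ (fieldInChart 𝓘(ℝ, E) X v.proj) (extChartAt 𝓘(ℝ, E) v.proj v.proj) u.1) := by
  obtain ⟨h1, h2⟩ := fderiv_vLift_lagrangian hL hX v
  have h3 := dFun_eq_of_eventuallyEq_comp_chart 𝓘(ℝ, E).tangent
    (mem_extChartAt_source (I := 𝓘(ℝ, E).tangent) v) h1.hasFDerivAt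
    (vLift_lagrangian_eventuallyEq hL X v) u
  rw [chartD_self] at h3
  exact h3.trans (h2 u)

lemma dFun_sub_vLift_lagrangian {L : TangentBundle 𝓘(ℝ, E) Q → ℝ}
    (hL : ContMDiff 𝓘(ℝ, E).tangent 𝓘(ℝ, ℝ) ∞ L) {X : VField 𝓘(ℝ, E) Q}
    (hX : SmoothVField 𝓘(ℝ, E) X) {f : TangentBundle 𝓘(ℝ, E) Q → ℝ}
    (hf : ContMDiff 𝓘(ℝ, E).tangent 𝓘(ℝ, ℝ) ∞ f) (v : TangentBundle 𝓘(ℝ, E) Q) (u : E × E) :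
    dFun 𝓘(ℝ, E).tangent (fun v => f v - dFun 𝓘(ℝ, E).tangent L v (vLift X v)) v u =
      dFun 𝓘(ℝ, E).tangent f v u -
        dFun 𝓘(ℝ, E).tangent (fun v => dFun 𝓘(ℝ, E).tangent L v (vLift X v)) v u := by
  have hv := mem_extChartAt_source (I := 𝓘(ℝ, E).tangent) v
  obtain ⟨h1, h2⟩ := fderiv_vLift_lagrangian hL hX v
  have h0 := ((contDiffAt_comp_chart_symm 𝓘(ℝ, E).tangent hf hv).differentiableAt
    (by simp)).hasFDerivAt
  have h3 := dFun_eq_of_eventuallyEq_comp_chart 𝓘(ℝ, E).tangent hv (h0.sub h1.hasFDerivAt)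
    ((eventuallyEq_comp_chart_symm_comp_chart 𝓘(ℝ, E).tangent f hv).sub
      (vLift_lagrangian_eventuallyEq hL X v)) u
  have h4 := dFun_eq_fderiv_comp_chartD 𝓘(ℝ, E).tangent hf hv u
  have h5 := dFun_eq_of_eventuallyEq_comp_chart 𝓘(ℝ, E).tangent hv h1.hasFDerivAt
    (vLift_lagrangian_eventuallyEq hL X v) u
  rw [h4, h5]
  exact h3

lemma differentiableAt_fieldInChart_cLift {X : VField 𝓘(ℝ, E) Q} (hX : SmoothVField 𝓘(ℝ, E) X)
    (v : TangentBundle 𝓘(ℝ, E) Q) :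
    DifferentiableAt ℝ (fieldInChart 𝓘(ℝ, E).tangent (cLift X) v)
      (extChartAt 𝓘(ℝ, E).tangent v v) := by
  have h2 := contDiffAt_fieldInChart_fst hX v
  have h3 := (h2.fderiv_right (m := 1) (by norm_cast)).differentiableAt one_ne_zero
  have h4 : DifferentiableAt ℝ (fun z : E × E => (fieldInChart 𝓘(ℝ, E) X v.proj z.1,
      fderiv ℝ (fieldInChart 𝓘(ℝ, E) X v.proj) z.1 z.2)) (extChartAt 𝓘(ℝ, E).tangent v v) :=
    ((h2.differentiableAt (by simp)).comp (extChartAt 𝓘(ℝ, E).tangent v v)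
      differentiableAt_fst).prodMk
      ((h3.comp (extChartAt 𝓘(ℝ, E).tangent v v) differentiableAt_fst).clm_apply
        differentiableAt_snd)
  refine h4.congr_of_eventuallyEq ?_
  filter_upwards [extChartAt_target_mem_nhds (I := 𝓘(ℝ, E).tangent) v] with z hz
  have hs := (extChartAt 𝓘(ℝ, E).tangent v).map_target hz
  have h5 := fieldInChart_extChartAt 𝓘(ℝ, E).tangent (cLift X) hs
  rw [chartD_cLift hX (mem_tangent_extChartAt_source.1 hs),
    (extChartAt 𝓘(ℝ, E).tangent v).right_inv hz] at h5
  exact h5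

lemma alphaForm_cLift (L : TangentBundle 𝓘(ℝ, E) Q → ℝ) (X : VField 𝓘(ℝ, E) Q) :
    (fun v => alphaForm L v (cLift X v)) = fun v => dFun 𝓘(ℝ, E).tangent L v (vLift X v) := by
  funext v
  have h : dProj v (cLift X v) = X v.proj := by
    rw [cLift_apply]
    exact dProj_apply v _
  exact congrArg (fun b => dFun 𝓘(ℝ, E).tangent L v (vertLift v b)) h

/-- Cartan's formula for `α_L` and `X^c`: `ℒ_{X^c} α_L = - i_{X^c} ω_L + d(X^v(L))`. -/
lemma lieDerivForm_cLift_alphaForm {L : TangentBundle 𝓘(ℝ, E) Q → ℝ}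
    (hL : ContMDiff 𝓘(ℝ, E).tangent 𝓘(ℝ, ℝ) ∞ L) {X : VField 𝓘(ℝ, E) Q}
    (hX : SmoothVField 𝓘(ℝ, E) X) (v : TangentBundle 𝓘(ℝ, E) Q) (u : E × E) :
    lieDerivForm 𝓘(ℝ, E).tangent (cLift X) (alphaForm L) v u = -omegaForm L v (cLift X v) u +
      dFun 𝓘(ℝ, E).tangent (fun v => dFun 𝓘(ℝ, E).tangent L v (vLift X v)) v u := by
  have h := lieDerivForm_eq_extDerivForm_add 𝓘(ℝ, E).tangent (cLift X) (alphaForm L) v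
    (hasFDerivAt_formInChart_alphaForm hL v).differentiableAt
    (differentiableAt_fieldInChart_cLift hX v) u
  rw [alphaForm_cLift] at h
  have h2 : omegaForm L v (cLift X v) u =
    -extDerivForm 𝓘(ℝ, E).tangent (alphaForm L) v (cLift X v) u := rfl
  rw [h2, neg_neg]
  exact h

/-- `ℒ_{X^c} α_L` is semibasic. -/
lemma lieDerivForm_cLift_alphaForm_vertical {L : TangentBundle 𝓘(ℝ, E) Q → ℝ}
    (hL : ContMDiff 𝓘(ℝ, E).tangent 𝓘(ℝ, ℝ) ∞ L) {X : VField 𝓘(ℝ, E) Q}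
    (hX : SmoothVField 𝓘(ℝ, E) X) (v : TangentBundle 𝓘(ℝ, E) Q) (c : E) :
    lieDerivForm 𝓘(ℝ, E).tangent (cLift X) (alphaForm L) v ((0, c) : E × E) = 0 := by
  rw [lieDerivForm_cLift_alphaForm hL hX v (0, c), cLift_apply, omegaForm_apply hL v,
    dFun_vLift_lagrangian hL hX v (0, c)]
  simp only [map_zero, Prod.mk_zero_zero]
  ring

/-! ### The forced Euler–Lagrange vector field -/

/-- The fibre Hessian of `L` is nondegenerate in bundle coordinates. -/
lemma Regular.eq_zero_of_hessian {L : TangentBundle 𝓘(ℝ, E) Q → ℝ} (hreg : Regular L)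
    (hL : ContMDiff 𝓘(ℝ, E).tangent 𝓘(ℝ, ℝ) ∞ L) (v : TangentBundle 𝓘(ℝ, E) Q) (b : E)
    (hb : ∀ c : E, fderiv ℝ (fderiv ℝ (localLagrangian L v)) (extChartAt 𝓘(ℝ, E).tangent v v)
      (0, b) (0, c) = 0) : b = 0 := by
  set x := extChartAt 𝓘(ℝ, E) v.proj v.proj with hx
  set Λ := localLagrangian L v
  have hq := mem_extChartAt_source (I := 𝓘(ℝ, E)) v.proj
  have hz : ∀ w : E, (x, w) ∈ (extChartAt 𝓘(ℝ, E).tangent v).target := fun w =>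
    mem_tangent_extChartAt_target.2 ((extChartAt 𝓘(ℝ, E) v.proj).map_source hq)
  have h1 : (fun w : E => L ⟨v.proj, w⟩) = fun w : E => Λ (x, w) := by
    funext w
    have h := tangent_extChartAt_apply (v₀ := v) (v := ⟨v.proj, w⟩) hq
    rw [chartD_self] at h
    have h' : extChartAt 𝓘(ℝ, E).tangent v ⟨v.proj, w⟩ = (x, w) := h
    rw [← h']
    exact congrArg L ((extChartAt 𝓘(ℝ, E).tangent v).left_inv
      (mem_tangent_extChartAt_source (v := ⟨v.proj, w⟩).2 hq)).symm
  have hi : ∀ w : E, HasFDerivAt (fun w : E => (x, w)) (ContinuousLinearMap.inr ℝ E E) w :=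
    fun w => hasFDerivAt_prodMk_right x w
  have h2 : fderiv ℝ (fun w : E => L ⟨v.proj, w⟩) =
      fun w => (fderiv ℝ Λ (x, w)).comp (ContinuousLinearMap.inr ℝ E E) := by
    rw [h1]
    funext w
    exact (((contDiffAt_localLagrangian hL (hz w)).differentiableAt
      (by simp)).hasFDerivAt.comp w (hi w)).fderiv
  let y : E := v.snd
  have h3 : HasFDerivAt (fun w : E => (fderiv ℝ Λ (x, w)).comp (ContinuousLinearMap.inr ℝ E E))
      ((ContinuousLinearMap.precomp ℝ (ContinuousLinearMap.inr ℝ E E)).comp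
        ((fderiv ℝ (fderiv ℝ Λ) (x, y)).comp (ContinuousLinearMap.inr ℝ E E))) y :=
    HasFDerivAt.comp (g := ContinuousLinearMap.precomp ℝ (ContinuousLinearMap.inr ℝ E E)) y
      (ContinuousLinearMap.precomp ℝ (ContinuousLinearMap.inr ℝ E E)).hasFDerivAt
      ((differentiableAt_fderiv_localLagrangian hL (hz y)).hasFDerivAt.comp y (hi y))
  have h4 := hreg v
  rw [h2] at h4
  have h5 := h3.fderiv
  obtain ⟨A, hA⟩ := h4
  have h6 : A b = 0 := by
    have h7 : A b = fderiv ℝ (fun w : E => (fderiv ℝ Λ (x, w)).comp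
      (ContinuousLinearMap.inr ℝ E E)) y b := DFunLike.congr_fun hA b
    rw [h7, h5]
    ext c
    have h8 := hb c
    rw [tangent_extChartAt_self] at h8
    exact h8
  exact (map_eq_zero_iff A A.injective).1 h6

variable [FiniteDimensional ℝ E]

lemma Regular.omegaForm_isInvertible {L : TangentBundle 𝓘(ℝ, E) Q → ℝ} (hreg : Regular L)
    (hL : ContMDiff 𝓘(ℝ, E).tangent 𝓘(ℝ, ℝ) ∞ L) (v : TangentBundle 𝓘(ℝ, E) Q) :
    (omegaForm L v).IsInvertible := by
  refine isInvertible_of_nondegenerate (G := E × E) fun u hu => ?_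
  have h := fun w : E × E => (omegaForm_apply hL v u w).symm.trans (DFunLike.congr_fun hu w)
  set B := fderiv ℝ (fderiv ℝ (localLagrangian L v)) (extChartAt 𝓘(ℝ, E).tangent v v)
  have h0 : ∀ w : E × E, B w (0, u.1) - B u (0, w.1) = 0 := h
  have h1 : u.1 = 0 := by
    refine hreg.eq_zero_of_hessian hL v u.1 fun c => ?_
    rw [fderiv_fderiv_localLagrangian_symm hL]
    have := h0 (0, c)
    simp only [Prod.mk_zero_zero, map_zero, sub_zero] at this
    exact this
  have h2 : u.2 = 0 := by
    refine hreg.eq_zero_of_hessian hL v u.2 fun c => ?_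
    have := h0 (c, 0)
    have h3 : u = (0, u.2) := Prod.ext h1 rfl
    rw [h1, ← Prod.zero_eq_mk, map_zero, zero_sub, neg_eq_zero, h3] at this
    exact this
  exact Prod.ext h1 h2

/-- The defining equation `i_ξ ω_L = dE_L + β` of `ξ = forcedEL L β`; the inverse in the definition
of `ξ` is a true inverse by regularity. -/
lemma omegaForm_forcedEL {L : TangentBundle 𝓘(ℝ, E) Q → ℝ} (hreg : Regular L)
    (hL : ContMDiff 𝓘(ℝ, E).tangent 𝓘(ℝ, ℝ) ∞ L)
    (β : OneForm 𝓘(ℝ, E).tangent (TangentBundle 𝓘(ℝ, E) Q)) (v : TangentBundle 𝓘(ℝ, E) Q)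
    (w : E × E) :
    omegaForm L v (forcedEL L β v) w = dFun 𝓘(ℝ, E).tangent (energy L) v w + β v w := by
  obtain ⟨A, hA⟩ := hreg.omegaForm_isInvertible hL v
  have h : forcedEL L β v = (omegaForm L v).inverse
    (dFun 𝓘(ℝ, E).tangent (energy L) v + β v) := rfl
  rw [h, ← hA, ContinuousLinearMap.inverse_equiv]
  exact DFunLike.congr_fun (A.apply_symm_apply _) w

omit [FiniteDimensional ℝ E] in
lemma Semibasic.apply_vertical {β : OneForm 𝓘(ℝ, E).tangent (TangentBundle 𝓘(ℝ, E) Q)}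
    (hβs : Semibasic β) (v : TangentBundle 𝓘(ℝ, E) Q) (c : E) : β v ((0, c) : E × E) = 0 :=
  hβs v _ (dProj_apply v (0, c))

/-- The forced Euler–Lagrange field is a second order differential equation, `Tτ_Q ∘ ξ = id`. -/
lemma forcedEL_fst {L : TangentBundle 𝓘(ℝ, E) Q → ℝ} (hreg : Regular L)
    (hL : ContMDiff 𝓘(ℝ, E).tangent 𝓘(ℝ, ℝ) ∞ L)
    {β : OneForm 𝓘(ℝ, E).tangent (TangentBundle 𝓘(ℝ, E) Q)} (hβs : Semibasic β)
    (v : TangentBundle 𝓘(ℝ, E) Q) : (forcedEL L β v : E × E).1 = v.snd := by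
  have hy : (extChartAt 𝓘(ℝ, E).tangent v v).2 = v.snd :=
    congrArg Prod.snd (tangent_extChartAt_self v)
  refine (sub_eq_zero.1 (hreg.eq_zero_of_hessian hL v _ fun c => ?_)).trans hy
  have h := (omegaForm_apply hL v (forcedEL L β v) (0, c)).symm.trans
    (omegaForm_forcedEL hreg hL β v (0, c))
  rw [dFun_energy hL v, hβs.apply_vertical v c] at h
  rw [fderiv_fderiv_localLagrangian_symm hL]
  set B := fderiv ℝ (fderiv ℝ (localLagrangian L v)) (extChartAt 𝓘(ℝ, E).tangent v v)
  have h1 : ∀ a b : E, ((0, a - b) : E × E) = (0, a) - (0, b) := by simp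
  rw [h1, map_sub]
  simp only [Prod.mk_zero_zero, map_zero, sub_zero, add_zero] at h
  exact sub_eq_zero.2 h

/-- The forced Euler–Lagrange equations `ξ(∂L/∂q̇ⁱ) = ∂L/∂qⁱ - βᵢ`. -/
lemma forcedEL_eulerLagrange {L : TangentBundle 𝓘(ℝ, E) Q → ℝ} (hreg : Regular L)
    (hL : ContMDiff 𝓘(ℝ, E).tangent 𝓘(ℝ, ℝ) ∞ L)
    {β : OneForm 𝓘(ℝ, E).tangent (TangentBundle 𝓘(ℝ, E) Q)} (hβs : Semibasic β)
    (v : TangentBundle 𝓘(ℝ, E) Q) (w : E × E) :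
    fderiv ℝ (fderiv ℝ (localLagrangian L v)) (extChartAt 𝓘(ℝ, E).tangent v v)
      (forcedEL L β v) (0, w.1) =
      fderiv ℝ (localLagrangian L v) (extChartAt 𝓘(ℝ, E).tangent v v) (w.1, 0) - β v w := by
  have h := (omegaForm_apply hL v (forcedEL L β v) w).symm.trans
    (omegaForm_forcedEL hreg hL β v w)
  rw [dFun_energy hL v] at h
  have h1 : (forcedEL L β v : E × E).1 = (extChartAt 𝓘(ℝ, E).tangent v v).2 :=
    (forcedEL_fst hreg hL hβs v).trans (congrArg Prod.snd (tangent_extChartAt_self v)).symm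
  rw [h1] at h
  linear_combination -h

/-- `ξ(X^v(L)) = X^c(L) - β(X^c)`. -/
lemma dFun_vLift_lagrangian_forcedEL {L : TangentBundle 𝓘(ℝ, E) Q → ℝ} (hreg : Regular L)
    (hL : ContMDiff 𝓘(ℝ, E).tangent 𝓘(ℝ, ℝ) ∞ L)
    {β : OneForm 𝓘(ℝ, E).tangent (TangentBundle 𝓘(ℝ, E) Q)} (hβs : Semibasic β)
    {X : VField 𝓘(ℝ, E) Q} (hX : SmoothVField 𝓘(ℝ, E) X) (v : TangentBundle 𝓘(ℝ, E) Q) :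
    dFun 𝓘(ℝ, E).tangent (fun v => dFun 𝓘(ℝ, E).tangent L v (vLift X v)) v (forcedEL L β v) =
      dFun 𝓘(ℝ, E).tangent L v (cLift X v) - β v (cLift X v) := by
  have h1 := dFun_vLift_lagrangian hL hX v (forcedEL L β v)
  have h2 := forcedEL_eulerLagrange hreg hL hβs v (cLift X v)
  have h3 := dFun_lagrangian_self hL v (cLift X v)
  have h4 := cLift_apply X v
  have h5 := forcedEL_fst hreg hL hβs v
  set a : E := fderiv ℝ (fieldInChart 𝓘(ℝ, E) X v.proj)
      (extChartAt 𝓘(ℝ, E) v.proj v.proj) v.snd with ha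
  have h6 : (cLift X v : E × E).1 = X v.proj := congrArg Prod.fst h4
  have h7 : ∀ b : E, ((b, a) : E × E) = (b, 0) + (0, a) := by simp
  rw [h5] at h1
  rw [h6] at h2
  have h8 := (congrArg (fderiv ℝ (localLagrangian L v) (extChartAt 𝓘(ℝ, E).tangent v v))
    (h4.trans (h7 (X v.proj)))).trans (map_add _ _ _)
  linear_combination h1 + h2 - h3 - h8

/-- If `ℒ_{X^c} α_L = df` then `ξ(f - X^v(L)) = X^c(E_L) + β(X^c)`. -/
lemma dFun_sub_vLift_lagrangian_forcedEL {L : TangentBundle 𝓘(ℝ, E) Q → ℝ} (hreg : Regular L)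
    (hL : ContMDiff 𝓘(ℝ, E).tangent 𝓘(ℝ, ℝ) ∞ L)
    (β : OneForm 𝓘(ℝ, E).tangent (TangentBundle 𝓘(ℝ, E) Q))
    {X : VField 𝓘(ℝ, E) Q} (hX : SmoothVField 𝓘(ℝ, E) X) {f : TangentBundle 𝓘(ℝ, E) Q → ℝ}
    (hf : ContMDiff 𝓘(ℝ, E).tangent 𝓘(ℝ, ℝ) ∞ f)
    (h : lieDerivForm 𝓘(ℝ, E).tangent (cLift X) (alphaForm L) = dFun 𝓘(ℝ, E).tangent f)
    (v : TangentBundle 𝓘(ℝ, E) Q) :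
    dFun 𝓘(ℝ, E).tangent (fun v => f v - dFun 𝓘(ℝ, E).tangent L v (vLift X v)) v
        (forcedEL L β v) =
      dFun 𝓘(ℝ, E).tangent (energy L) v (cLift X v) + β v (cLift X v) := by
  have h1 := lieDerivForm_cLift_alphaForm hL hX v (forcedEL L β v)
  have h2 := dFun_sub_vLift_lagrangian hL hX hf v (forcedEL L β v)
  have h3 := omegaForm_forcedEL hreg hL β v (cLift X v)
  have h4 := omegaForm_apply hL v (cLift X v) (forcedEL L β v)
  have h5 := omegaForm_apply hL v (forcedEL L β v) (cLift X v)
  rw [h] at h1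
  linear_combination h1 + h2 + h3 - h4 - h5

/-- A function whose differential is semibasic is the pullback of a function on `Q`. If it is
moreover conserved, its differential vanishes, because the velocities of a second order equation
exhaust the tangent spaces of `Q`. -/
lemma dFun_eq_zero_of_vertical_of_forcedEL {L : TangentBundle 𝓘(ℝ, E) Q → ℝ} (hreg : Regular L)
    (hL : ContMDiff 𝓘(ℝ, E).tangent 𝓘(ℝ, ℝ) ∞ L)
    {β : OneForm 𝓘(ℝ, E).tangent (TangentBundle 𝓘(ℝ, E) Q)} (hβs : Semibasic β)
    {f : TangentBundle 𝓘(ℝ, E) Q → ℝ} (hf : ContMDiff 𝓘(ℝ, E).tangent 𝓘(ℝ, ℝ) ∞ f)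
    (hvert : ∀ (v : TangentBundle 𝓘(ℝ, E) Q) (c : E),
      dFun 𝓘(ℝ, E).tangent f v ((0, c) : E × E) = 0)
    (hξ : ∀ v, dFun 𝓘(ℝ, E).tangent f v (forcedEL L β v) = 0) :
    dFun 𝓘(ℝ, E).tangent f = 0 := by
  have hconst : ∀ (q : Q) (w : E), f ⟨q, w⟩ = f ⟨q, (0 : E)⟩ := by
    intro q w
    have hd : ∀ w : E, HasMFDerivAt 𝓘(ℝ, E) 𝓘(ℝ, ℝ) (fun w : E => f ⟨q, w⟩) w
        (0 : E →L[ℝ] ℝ) := by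
      intro w
      let v : TangentBundle 𝓘(ℝ, E) Q := ⟨q, w⟩
      have h2 : HasMFDerivAt 𝓘(ℝ, E) 𝓘(ℝ, E).tangent
          (fun w : E => (⟨q, w⟩ : TangentBundle 𝓘(ℝ, E) Q)) w (vertLift v) :=
        ((contMDiff_fibre_inclusion (E := E) q).mdifferentiable (by simp) w).hasMFDerivAt
      have h3 : HasMFDerivAt 𝓘(ℝ, E).tangent 𝓘(ℝ, ℝ) f v (dFun 𝓘(ℝ, E).tangent f v) :=
        (hf.mdifferentiable (by simp) v).hasMFDerivAt
      have h4 := HasMFDerivAt.comp (x := w) (g := f)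
        (f := fun w : E => (⟨q, w⟩ : TangentBundle 𝓘(ℝ, E) Q)) h3 h2
      have h5 : (dFun 𝓘(ℝ, E).tangent f v).comp (vertLift v) = (0 : E →L[ℝ] ℝ) := by
        ext c
        exact (congrArg (dFun 𝓘(ℝ, E).tangent f v) (vertLift_apply v c)).trans (hvert v c)
      exact h4.congr_mfderiv h5
    have hd' : ∀ w : E, HasFDerivAt (fun w : E => f ⟨q, w⟩) (0 : E →L[ℝ] ℝ) w :=
      fun w => (hd w).hasFDerivAt
    exact is_const_of_fderiv_eq_zero (fun w => (hd' w).differentiableAt)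
      (fun w => (hd' w).fderiv) w 0
  -- `f = g ∘ τ_Q`, where `g` is the restriction of `f` to the zero section
  let g : Q → ℝ := fun q => f ⟨q, (0 : E)⟩
  have hg : ContMDiff 𝓘(ℝ, E) 𝓘(ℝ, ℝ) ∞ g :=
    hf.comp (Bundle.contMDiff_zeroSection ℝ (TangentSpace 𝓘(ℝ, E) : Q → Type _))
  have hfg : f = g ∘ fun w : TangentBundle 𝓘(ℝ, E) Q => w.proj :=
    funext fun v => hconst v.proj v.snd
  have hdf : ∀ (v : TangentBundle 𝓘(ℝ, E) Q) (u : E × E),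
      dFun 𝓘(ℝ, E).tangent f v u = dFun 𝓘(ℝ, E) g v.proj u.1 := by
    intro v u
    have h1 := mfderiv_comp (I := 𝓘(ℝ, E).tangent) (I' := 𝓘(ℝ, E)) (I'' := 𝓘(ℝ, ℝ)) v
      (g := g) (f := fun w : TangentBundle 𝓘(ℝ, E) Q => w.proj)
      (hg.mdifferentiable (by simp) v.proj)
      ((Bundle.contMDiff_proj (n := 1) (TangentSpace 𝓘(ℝ, E))).mdifferentiable one_ne_zero v)
    rw [← hfg] at h1
    exact (DFunLike.congr_fun h1 u).trans
      (congrArg (dFun 𝓘(ℝ, E) g v.proj) (dProj_apply v u))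
  funext v
  refine ContinuousLinearMap.ext fun u => ?_
  have h1 := hdf v u
  -- at the point `u.1` of the fibre, the second order equation has velocity `u.1`
  have h2 := hξ ⟨v.proj, (u : E × E).1⟩
  have h3 := hdf ⟨v.proj, (u : E × E).1⟩ (forcedEL L β ⟨v.proj, (u : E × E).1⟩)
  rw [forcedEL_fst hreg hL hβs] at h3
  exact h1.trans (h3.symm.trans h2)

end Coordinates

end ForcedLagrangian

end

open ForcedLagrangian in
theorem mainTheorem2
    {E : Type*} [NormedAddCommGroup E] [NormedSpace ℝ E] [FiniteDimensional ℝ E]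
    {Q : Type*} [TopologicalSpace Q] [ChartedSpace E Q] [IsManifold 𝓘(ℝ, E) ∞ Q]
    (L : TangentBundle 𝓘(ℝ, E) Q → ℝ)
    (hL : ContMDiff 𝓘(ℝ, E).tangent 𝓘(ℝ, ℝ) ∞ L)
    (hreg : Regular L)
    (β : OneForm 𝓘(ℝ, E).tangent (TangentBundle 𝓘(ℝ, E) Q))
    (hβ : SmoothOneForm 𝓘(ℝ, E).tangent β)
    (hβs : Semibasic β)
    (X : VField 𝓘(ℝ, E) Q)
    (hX : SmoothVField 𝓘(ℝ, E) X) :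
    (∀ f : TangentBundle 𝓘(ℝ, E) Q → ℝ, ContMDiff 𝓘(ℝ, E).tangent 𝓘(ℝ, ℝ) ∞ f →
      lieDerivForm 𝓘(ℝ, E).tangent (cLift X) (alphaForm L) = dFun 𝓘(ℝ, E).tangent f →
      (IsNoetherSymmetry L β X ↔
        IsConserved L β (fun v => f v - dFun 𝓘(ℝ, E).tangent L v (vLift X v)))) ∧
    (IsForcedSymmetry L β X ↔
      IsConserved L β (fun v => dFun 𝓘(ℝ, E).tangent L v (vLift X v))) ∧
    (IsForcedSymmetry L β X →
      (IsNoetherSymmetry L β X ↔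
        lieDerivForm 𝓘(ℝ, E).tangent (cLift X) (alphaForm L) = 0)) := by
  have part1 : ∀ f : TangentBundle 𝓘(ℝ, E) Q → ℝ, ContMDiff 𝓘(ℝ, E).tangent 𝓘(ℝ, ℝ) ∞ f →
      lieDerivForm 𝓘(ℝ, E).tangent (cLift X) (alphaForm L) = dFun 𝓘(ℝ, E).tangent f →
      (IsNoetherSymmetry L β X ↔
        IsConserved L β (fun v => f v - dFun 𝓘(ℝ, E).tangent L v (vLift X v))) := by
    intro f hf h
    have key := dFun_sub_vLift_lagrangian_forcedEL hreg hL β hX hf h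
    exact ⟨fun hN v => (key v).trans (hN.1 v), fun hC => ⟨fun v => (key v).symm.trans (hC v),
      f, hf, h⟩⟩
  have part2 : IsForcedSymmetry L β X ↔
      IsConserved L β (fun v => dFun 𝓘(ℝ, E).tangent L v (vLift X v)) := by
    have key := dFun_vLift_lagrangian_forcedEL hreg hL hβs hX
    exact ⟨fun hS v => (key v).trans (sub_eq_zero.2 (hS v)),
      fun hC v => sub_eq_zero.1 ((key v).symm.trans (hC v))⟩
  refine ⟨part1, part2, fun hS => ⟨fun hN => ?_, fun h => ?_⟩⟩
  · obtain ⟨f, hf, h⟩ := hN.2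
    rw [h]
    refine dFun_eq_zero_of_vertical_of_forcedEL hreg hL hβs hf (fun v c => ?_) (fun v => ?_)
    · rw [← h]
      exact lieDerivForm_cLift_alphaForm_vertical hL hX v c
    · have h1 := dFun_sub_vLift_lagrangian hL hX hf v (forcedEL L β v)
      have h2 := (part1 f hf h).1 hN v
      have h3 := part2.1 hS v
      linear_combination h2 + h3 - h1
  · have h0 : dFun 𝓘(ℝ, E).tangent (fun _ : TangentBundle 𝓘(ℝ, E) Q => (0 : ℝ)) = 0 := by
      funext v
      exact mfderiv_const
    refine (part1 (fun _ => 0) contMDiff_const (h.trans h0.symm)).2 fun v => ?_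
    have h1 := dFun_sub_vLift_lagrangian hL hX (f := fun _ => 0) contMDiff_const v
      (forcedEL L β v)
    have h3 := part2.1 hS v
    rw [h0] at h1
    have h4 : (0 : OneForm 𝓘(ℝ, E).tangent (TangentBundle 𝓘(ℝ, E) Q)) v (forcedEL L β v) = 0 := rfl
    linear_combination h1 + h4 - h3
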